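/- A basic tree on $2n$ vertices is a tree $T$ with $2n$ vertices which either has exactly two vertices, or has $n$ leaves and $n$ non-leaves such that every non-leaf is adjacent to exactly one leaf. For a finite directed graph $D$, let $\Delta(D)$ be the simplicial complex whose vertices are the directed edges of $D$ and whose faces are the sets of directed edges that form a directed forest (a disjoint union of rooted directed trees, i.e. acyclic directed graphs with a root $r$ such that every vertex is reached from $r$ by a unique directed path). A set of facets (maximal faces) of a complex is called a set of generating facets if removing their interiors makes the complex contractible. Let $T$ be a basic tree on $2n$ vertices and let $D$ be the directed graph obtained from $T$ by replacing every edge by a pair of directed edges going in opposite directions. Then $\Delta(D)$ has the homotopy type of the sphere $\mathbb{S}^{n-1}$. Moreover, the vertices of $T$ can be labelled $v_1,\dots,v_n,u_1,\dots,u_n$ (each vertex listed once) so that every $v_i$ is a leaf and every $v_iu_i$ is an edge of $T$; for every such labelling, $G=\{\overrightarrow{v_1u_1},\dots,\overrightarrow{v_nu_n}\}$ is a facet of $\Delta(D)$ and $\{G\}$ is a set of generating facets. If $n\ge 2$, then $\{G\}$ is the only set of generating facets of $\Delta(D)$, so $G$ is its unique generating facet. If $n=1$, every set of generating facets is $\{\{\overrightarrow{v_1u_1}\}\}$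 or $\{\{\overrightarrow{u_1v_1}\}\}$. -/

import Mathlib

section DirectedForests

variable {V : Type*}

/-- `p` lists the successive vertices of a directed path from `x` to `y` all of whose edges
lie in `A`; the pair `(a, b)` stands for the directed edge from `a` to `b`. -/
def IsDirectedPath (A : Set (V × V)) (x y : V) (p : List V) : Prop :=
  p.IsChain (fun a b => (a, b) ∈ A) ∧ p.Nodup ∧ p.head? = some x ∧ p.getLast? = some y

/-- There is no directed cycle (loops included) with edges in `A`. -/
def IsAcyclicEdgeSet (A : Set (V × V)) : Prop :=
  ∀ x, ¬ Relation.TransGen (fun a b => (a, b) ∈ A) x x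

/-- The directed graph with vertex set `W` and edge set `A` is a directed tree with root `r`. -/
structure IsDirectedTree (W : Set V) (A : Set (V × V)) (r : V) : Prop where
  root_mem : r ∈ W
  edge_mem : ∀ a b, (a, b) ∈ A → a ∈ W ∧ b ∈ W
  acyclic : IsAcyclicEdgeSet A
  existsUnique_path : ∀ x ∈ W, ∃! p : List V, IsDirectedPath A r x p

/-- `A` is the edge set of a directed forest, that is, of a family (of pairs
(vertex set, edge set)) of vertex-disjoint directed trees. -/
def IsDirectedForest (A : Set (V × V)) : Prop :=
  ∃ 𝓕 : Set (Set V × Set (V × V)),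
    (∀ t ∈ 𝓕, ∃ r, IsDirectedTree t.1 t.2 r) ∧
    𝓕.PairwiseDisjoint Prod.fst ∧
    A = ⋃ t ∈ 𝓕, t.2

theorem reflTransGen_of_mem_chain {R : V → V → Prop} (p : List V) (b c : V)
    (hp : p.IsChain R) (hb : p.getLast? = some b) (hc : c ∈ p) : Relation.ReflTransGen R c b := by
  induction p using List.reverseRecOn generalizing b with
  | nil => simp at hc
  | append_singleton l a ih =>
    simp only [List.getLast?_append, List.getLast?_singleton, Option.some_or,
      Option.some.injEq] at hb
    subst hb
    rw [List.isChain_append] at hp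
    rcases List.mem_append.1 hc with h | h
    · obtain ⟨d, hd⟩ : ∃ d, l.getLast? = some d := by
        cases hl : l.getLast? with
        | none => simp at hl; simp [hl] at h
        | some d => exact ⟨d, rfl⟩
      exact (ih d hp.1 hd h).tail (hp.2.2 d hd a (by simp))
    · simp at h; subst h; exact .refl

theorem IsDirectedPath.snoc {A : Set (V × V)} (hA : IsAcyclicEdgeSet A) {x b c : V} {p : List V}
    (hp : IsDirectedPath A x b p) (h : (b, c) ∈ A) : IsDirectedPath A x c (p ++ [c]) := by
  obtain ⟨h1, h2, h3, h4⟩ := hp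
  refine ⟨?_, ?_, ?_, ?_⟩
  · rw [List.isChain_append]
    refine ⟨h1, by simp, ?_⟩
    intro d hd e he
    simp [h4] at hd he
    subst hd he
    exact h
  · rw [List.nodup_append]
    refine ⟨h2, by simp, ?_⟩
    rintro d hd e he rfl
    simp at he
    subst he
    exact hA d (Relation.TransGen.tail' (reflTransGen_of_mem_chain p b d h1 h4 hd) h)
  · simp [h3]
  · simp

theorem IsDirectedForest.acyclic_and_unique {A : Set (V × V)} (hA : IsDirectedForest A) :
    IsAcyclicEdgeSet A ∧ ∀ a b c, (a, c) ∈ A → (b, c) ∈ A → a = b := by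
  obtain ⟨𝓕, hT, hd, rfl⟩ := hA
  have same : ∀ s ∈ 𝓕, ∀ t ∈ 𝓕, ∀ x, x ∈ s.1 → x ∈ t.1 → s = t := by
    intro s hs t ht x hxs hxt
    by_contra hne
    exact Set.disjoint_left.1 (hd hs ht hne) hxs hxt
  refine ⟨?_, ?_⟩
  · intro x hx
    have key : ∀ t ∈ 𝓕, x ∈ t.1 → ∀ y,
        Relation.TransGen (fun a b => (a, b) ∈ ⋃ t ∈ 𝓕, t.2) x y →
        y ∈ t.1 ∧ Relation.TransGen (fun a b => (a, b) ∈ t.2) x y := by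
      intro t ht hxt y hy
      induction hy with
      | single h =>
        simp only [Set.mem_iUnion] at h
        obtain ⟨s, hs, h⟩ := h
        obtain ⟨r, hr⟩ := hT s hs
        obtain rfl := same s hs t ht x (hr.edge_mem _ _ h).1 hxt
        exact ⟨(hr.edge_mem _ _ h).2, .single h⟩
      | tail _ h ih =>
        simp only [Set.mem_iUnion] at h
        obtain ⟨s, hs, h⟩ := h
        obtain ⟨r, hr⟩ := hT s hs
        obtain rfl := same s hs t ht _ (hr.edge_mem _ _ h).1 ih.1
        exact ⟨(hr.edge_mem _ _ h).2, ih.2.tail h⟩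
    obtain ⟨y, hy, -⟩ := Relation.TransGen.head'_iff.1 hx
    simp only [Set.mem_iUnion] at hy
    obtain ⟨s, hs, h⟩ := hy
    obtain ⟨r, hr⟩ := hT s hs
    exact hr.acyclic x (key s hs (hr.edge_mem _ _ h).1 x hx).2
  · intro a b c ha hb
    simp only [Set.mem_iUnion] at ha hb
    obtain ⟨s, hs, ha⟩ := ha
    obtain ⟨t, ht, hb⟩ := hb
    obtain ⟨r, hr⟩ := hT s hs
    obtain ⟨r', hr'⟩ := hT t ht
    obtain rfl := same s hs t ht c (hr.edge_mem _ _ ha).2 (hr'.edge_mem _ _ hb).2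
    obtain ⟨p, hp, -⟩ := hr.existsUnique_path a (hr.edge_mem _ _ ha).1
    obtain ⟨q, hq, -⟩ := hr.existsUnique_path b (hr.edge_mem _ _ hb).1
    have := (hr.existsUnique_path c (hr.edge_mem _ _ ha).2).unique
      (hp.snoc hr.acyclic ha) (hq.snoc hr.acyclic hb)
    have hpq : p = q := by simpa using this
    subst hpq
    simpa using hp.2.2.2.symm.trans hq.2.2.2

theorem isDirectedForest_of_acyclic [Finite V] {A : Set (V × V)} (hA : IsAcyclicEdgeSet A)
    (hu : ∀ a b c, (a, c) ∈ A → (b, c) ∈ A → a = b) : IsDirectedForest A := by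
  let R : V → V → Prop := fun a b => (a, b) ∈ A
  let S : V → V → Prop := Relation.TransGen R
  have hwf : WellFounded S := by
    have : IsTrans V S := ⟨fun _ _ _ h h' => h.trans h'⟩
    have : Std.Irrefl S := ⟨fun x h => hA x h⟩
    exact Finite.wellFounded_of_trans_of_irrefl S
  let IsRoot : V → Prop := fun r => ∀ a, (a, r) ∉ A
  have hroot : ∀ x, ∃ r, IsRoot r ∧ Relation.ReflTransGen R r x := by
    intro x
    induction x using hwf.induction with
    | _ x ih =>
      by_cases hx : IsRoot x
      · exact ⟨x, hx, .refl⟩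
      · simp only [IsRoot, not_forall, not_not] at hx
        obtain ⟨a, ha⟩ := hx
        obtain ⟨r, hr, hra⟩ := ih a (.single ha)
        exact ⟨r, hr, hra.tail ha⟩
  have huniq : ∀ r s x, IsRoot r → IsRoot s → Relation.ReflTransGen R r x →
      Relation.ReflTransGen R s x → r = s := by
    intro r s x hr hs hrx
    induction hrx with
    | refl =>
      intro hsx
      rcases Relation.ReflTransGen.cases_tail hsx with h | ⟨c, -, h⟩
      · exact h
      · exact absurd h (hr c)
    | tail _ hbc ih =>
      intro hsx
      rcases Relation.ReflTransGen.cases_tail hsx with h | ⟨c, h1, h2⟩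
      · subst h
        exact absurd hbc (hs _)
      · exact ih (by rwa [hu _ _ _ hbc h2])
  let W : V → Set V := fun r => {x | Relation.ReflTransGen R r x}
  let E : V → Set (V × V) := fun r => {e | e ∈ A ∧ Relation.ReflTransGen R r e.1}
  have hEac : ∀ r, IsAcyclicEdgeSet (E r) := fun r x hx => hA x (Relation.TransGen.mono (fun _ _ h => h.1) _ _ hx)
  refine ⟨{t | ∃ r, IsRoot r ∧ t = (W r, E r)}, ?_, ?_, ?_⟩
  · rintro _ ⟨r, hr, rfl⟩
    refine ⟨r, Relation.ReflTransGen.refl, fun a b h => ⟨h.2, h.2.tail h.1⟩, hEac r, ?_⟩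
    intro x hx
    refine existsUnique_of_exists_of_unique ?_ ?_
    · change Relation.ReflTransGen R r x at hx
      induction hx with
      | refl => exact ⟨[r], by simp [IsDirectedPath]⟩
      | tail h1 h2 ih =>
        obtain ⟨p, hp⟩ := ih
        exact ⟨_, hp.snoc (hEac r) ⟨h2, h1⟩⟩
    · intro p q hp hq
      replace hp := And.intro hp.1 hp.2.2
      replace hq := And.intro hq.1 hq.2.2
      clear hx
      induction p using List.reverseRecOn generalizing q x with
      | nil => simp at hp
      | append_singleton p a ih =>
        induction q using List.reverseRecOn with
        | nil => simp at hq
        | append_singleton q b _ =>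
          obtain ⟨hp1, hp2, hp3⟩ := hp
          obtain ⟨hq1, hq2, hq3⟩ := hq
          simp only [List.getLast?_append, List.getLast?_singleton, Option.some_or,
            Option.some.injEq] at hp3 hq3
          subst hp3
          subst hq3
          rw [List.isChain_append] at hp1 hq1
          have hlast : ∀ l : List V, l = [] ∨ ∃ d, l.getLast? = some d := by
            intro l
            cases hl : l.getLast? with
            | none => left; simpa using hl
            | some d => right; exact ⟨d, rfl⟩
          rcases hlast p with rfl | ⟨d, hd⟩ <;> rcases hlast q with rfl | ⟨e, he⟩
          · rfl
          · simp at hp2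
            subst hp2
            exact absurd (hq1.2.2 e he _ (by simp)).1 (hr e)
          · simp at hq2
            subst hq2
            exact absurd (hp1.2.2 d hd _ (by simp)).1 (hr d)
          · have hde : d = e := hu _ _ b (hp1.2.2 d hd b (by simp)).1
              (hq1.2.2 e he b (by simp)).1
            subst hde
            have hp0 : p ≠ [] := by rintro rfl; simp at hd
            have hq0 : q ≠ [] := by rintro rfl; simp at he
            rw [ih d q ⟨hp1.1, by simpa [List.head?_append_of_ne_nil _ hp0] using hp2, hd⟩
              ⟨hq1.1, by simpa [List.head?_append_of_ne_nil _ hq0] using hq2, he⟩]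
  · rintro _ ⟨r, hr, rfl⟩ _ ⟨s, hs, rfl⟩ hne
    refine Set.disjoint_left.2 fun x hx hx' => hne ?_
    rw [huniq r s x hr hs hx hx']
  · ext ⟨a, b⟩
    simp only [Set.mem_iUnion]
    constructor
    · intro h
      obtain ⟨r, hr, hra⟩ := hroot a
      exact ⟨(W r, E r), ⟨r, hr, rfl⟩, h, hra⟩
    · rintro ⟨_, ⟨r, hr, rfl⟩, h⟩
      exact h.1

theorem IsDirectedForest.mono [Finite V] {A B : Set (V × V)} (hA : IsDirectedForest A)
    (h : B ⊆ A) : IsDirectedForest B :=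
  isDirectedForest_of_acyclic
    (fun x hx => hA.acyclic_and_unique.1 x
      (Relation.TransGen.mono (fun _ _ h' => h h') _ _ hx))
    (fun a b c ha hb => hA.acyclic_and_unique.2 a b c (h ha) (h hb))

/-- The complex of directed trees `Δ(D)`: its faces are the (nonempty) sets of directed edges
of `D` that form a directed forest. -/
def directedTreeComplex [Finite V] (D : Digraph V) : PreAbstractSimplicialComplex (V × V) where
  faces := {F | F.Nonempty ∧ (∀ e ∈ F, D.Adj e.1 e.2) ∧ IsDirectedForest (F : Set (V × V))}
  isRelLowerSet_faces := fun _ hF => ⟨hF.1, fun _ hGF hG =>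
    ⟨hG, fun e he => hF.2.1 e (hGF he), hF.2.2.mono (Finset.coe_subset.2 hGF)⟩⟩

/-- The double directed graph of `T`: every edge `xy` is replaced by the two directed edges
from `x` to `y` and from `y` to `x`. -/
def doubleDirected (T : SimpleGraph V) : Digraph V where
  Adj x y := T.Adj x y

end DirectedForests

section Realization

variable {E : Type*} [Fintype E]

/-- The open simplex (relative interior of the closed simplex) spanned by the vertices in `F`,
in barycentric coordinates. -/
def openSimplex (F : Finset E) : Set (E → ℝ) :=
  {x | x ∈ stdSimplex ℝ E ∧ ∀ e, x e ≠ 0 ↔ e ∈ F}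

/-- The geometric realization of a finite simplicial complex, in barycentric coordinates. -/
def geomRealization (K : PreAbstractSimplicialComplex E) : Set (E → ℝ) :=
  ⋃ F ∈ K.faces, openSimplex F

/-- A facet is a maximal face. -/
def IsFacet (K : PreAbstractSimplicialComplex E) (F : Finset E) : Prop :=
  Maximal (fun G => G ∈ K.faces) F

/-- A set `S` of facets is a set of generating facets if removing the interiors of its members
makes the complex contractible. -/
def IsGeneratingSet (K : PreAbstractSimplicialComplex E) (S : Set (Finset E)) : Prop :=
  (∀ F ∈ S, IsFacet K F) ∧
    ContractibleSpace ↥(geomRealization K \ ⋃ F ∈ S, openSimplex F)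

end Realization

section BasicTrees

variable {V : Type*}

/-- A leaf is a vertex with exactly one neighbour. -/
def IsLeafOf (T : SimpleGraph V) (x : V) : Prop :=
  ∃! y, T.Adj x y

/-- A basic tree with `2 * n` vertices: either it has exactly two vertices, or it has `n` leaves
and `n` non-leaves and every non-leaf is adjacent to exactly one leaf. -/
def IsBasicTree (T : SimpleGraph V) (n : ℕ) : Prop :=
  T.IsTree ∧ Nat.card V = 2 * n ∧
    (Nat.card V = 2 ∨
      ({x | IsLeafOf T x}.ncard = n ∧ {x | ¬ IsLeafOf T x}.ncard = n ∧
        ∀ x, ¬ IsLeafOf T x → ∃! y, IsLeafOf T y ∧ T.Adj x y))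

/-- The vertices are `v 0, …, v (n - 1), u 0, …, u (n - 1)`, each listed once, every `v i` is a
leaf and every `v i` is joined to `u i` by a (peripheral) edge. If `n ≥ 2` then the `v i` are
all the leaves and the `u i` all the non-leaves; if `n = 1` both vertices are leaves. -/
structure IsLabelling (T : SimpleGraph V) {n : ℕ} (v u : Fin n → V) : Prop where
  bijective : Function.Bijective (Sum.elim v u)
  leaf : ∀ i, IsLeafOf T (v i)
  adj : ∀ i, T.Adj (v i) (u i)

/-- The set of directed edges from `v i` to `u i`. -/
def orientedEdges [DecidableEq V] {n : ℕ} (v u : Fin n → V) : Finset (V × V) :=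
  Finset.univ.image fun i => (v i, u i)

end BasicTrees

/-! A leaf edge of `T` carries two opposite directed edges, and a forest contains at most one of
them. Any choice of orientations of the leaf edges is a forest (`mem_faces_of_sign`), so these edges
span the boundary of a cross-polytope, a sphere of dimension `n - 1`. `toCross` maps the whole
realization to `ℝⁿ \ {0}`: it sends `v i → u i` to the `i`-th basis vector and every other edge at
`v i` or into `u i` to its negative. In a face nothing cancels, because in-degrees are at most one
and 2-cycles are excluded. `ofCross` maps back onto the cross-polytope, and the composites are
joined to the identities by straight lines; these stay in the complex because a forest may be
enlarged by all `u i → v i` whose reverse is absent (`union_mem_faces`). Removing the interior of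
`G` corresponds to removing the open positive orthant, which leaves a star-shaped set.

For uniqueness, a generating set must contain a facet made of leaf edges only: otherwise the
cross-polytope survives as a sphere inside a contractible space that `toCross` keeps away from zero
(`exists_mem_of_isGeneratingSet`). For `n ≥ 2` such a facet is `G`; for `n = 1` it is one of the two
orientations of the only edge. Generating sets form an antichain (`IsGeneratingSet.eq_of_subset`),
so nothing else can be in the set.

Both obstructions avoid homology. They rest on a form of Brouwer's theorem,
`exists_eq_zero_of_eq_self_of_le_norm`, proved by the Milnor–Rogers volume argument. -/

/-! ### Determinants along the line `id + t L` -/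

open Polynomial in
theorem LinearMap.exists_polynomial_eval_eq_det_id_add_smul {E : Type*} [AddCommGroup E]
    [Module ℝ E] [FiniteDimensional ℝ E] (L : E →ₗ[ℝ] E) :
    ∃ p : ℝ[X], p.natDegree ≤ Module.finrank ℝ E ∧
      ∀ t : ℝ, p.eval t = LinearMap.det (LinearMap.id + t • L) := by
  let b := Module.finBasis ℝ E
  let M := LinearMap.toMatrix b b L
  refine ⟨Matrix.det ((X : ℝ[X]) • M.map C + (1 : Matrix _ _ ℝ).map C), ?_, fun t => ?_⟩
  · simpa using Polynomial.natDegree_det_X_add_C_le M 1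
  · rw [← LinearMap.det_toMatrix b, ← Polynomial.coe_evalRingHom, RingHom.map_det]
    congr 1
    ext i j
    simp [M, Matrix.one_apply, LinearMap.toMatrix_apply, Finsupp.single_apply, add_comm, eq_comm]
    split_ifs <;> simp [mul_comm]

/-- The determinant of `id + t L` is a polynomial in `t` of degree at most the dimension, so
Lagrange interpolation recovers its value at `t = 1` from any distinct nodes. This carries volume
identities from small `t` to `t = 1`. -/
theorem LinearMap.det_id_add_eq_sum {E : Type*} [AddCommGroup E]
    [Module ℝ E] [FiniteDimensional ℝ E] {v : ℕ → ℝ} (hv : Function.Injective v)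
    (L : E →ₗ[ℝ] E) :
    LinearMap.det (LinearMap.id + L) = ∑ k ∈ Finset.range (Module.finrank ℝ E + 1),
      LinearMap.det (LinearMap.id + v k • L) *
        (Lagrange.basis (Finset.range (Module.finrank ℝ E + 1)) v k).eval 1 := by
  obtain ⟨p, hp, hev⟩ := L.exists_polynomial_eval_eq_det_id_add_smul
  have h1 : p = Lagrange.interpolate (Finset.range (Module.finrank ℝ E + 1)) v
      fun k => p.eval (v k) := by
    refine Lagrange.eq_interpolate hv.injOn ?_
    rw [Finset.card_range]
    exact lt_of_le_of_lt Polynomial.degree_le_natDegree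
      (by exact_mod_cast Nat.lt_succ_of_le hp)
  have h2 := congrArg (Polynomial.eval 1) h1
  rw [Lagrange.interpolate_apply, Polynomial.eval_finsetSum] at h2
  simpa [hev] using h2

/-! ### No-retraction theorem and zeros of continuous maps -/

section Retraction

open Metric MeasureTheory

variable {E : Type*} [NormedAddCommGroup E] [InnerProductSpace ℝ E] [FiniteDimensional ℝ E]

/-- Each `id + s • L` with `s` in `[0, 1]` is injective, so the determinant cannot change sign on
the path from `id`. -/
theorem ContinuousLinearMap.det_id_add_pos {L : E →L[ℝ] E} (hL : ‖L‖ < 1) :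
    0 < (ContinuousLinearMap.id ℝ E + L).det := by
  have hne : ∀ s ∈ Set.Icc (0 : ℝ) 1, (ContinuousLinearMap.id ℝ E + s • L).det ≠ 0 := by
    intro s hs h0
    have hinj : LinearMap.ker ((ContinuousLinearMap.id ℝ E + s • L : E →L[ℝ] E) : E →ₗ[ℝ] E) = ⊥ := by
      rw [LinearMap.ker_eq_bot']
      intro x hx
      by_contra hx0
      have h1 : x = -(s • L x) := by
        have : x + s • L x = 0 := by simpa using hx
        exact eq_neg_of_add_eq_zero_left this
      have h2 : ‖x‖ ≤ ‖L‖ * ‖x‖ := by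
        calc ‖x‖ = |s| * ‖L x‖ := by rw [h1, norm_neg, norm_smul, Real.norm_eq_abs, ← h1]
          _ ≤ 1 * (‖L‖ * ‖x‖) := by
            gcongr
            · rw [abs_of_nonneg hs.1]; exact hs.2
            · exact L.le_opNorm x
          _ = _ := one_mul _
      have h3 : 0 < ‖x‖ := norm_pos_iff.2 hx0
      nlinarith
    have := LinearMap.bot_lt_ker_of_det_eq_zero (f := ((ContinuousLinearMap.id ℝ E + s • L : E →L[ℝ] E) : E →ₗ[ℝ] E)) h0
    exact this.ne' hinj
  by_contra hneg
  have hcont : ContinuousOn (fun s : ℝ => (ContinuousLinearMap.id ℝ E + s • L).det) (Set.Icc 0 1) := by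
    refine Continuous.continuousOn ?_
    exact ContinuousLinearMap.continuous_det.comp (by fun_prop)
  have := intermediate_value_Icc' zero_le_one hcont
  obtain ⟨s, hs, h0⟩ := this (show (0 : ℝ) ∈ _ by
    constructor
    · simpa using hneg
    · simp [ContinuousLinearMap.det])
  exact hne s hs h0

/-- For a map `N` that preserves the ball and fixes the sphere, the maps `x + t (N x - x)` with
small `t` are bijections of the ball. -/
theorem image_ball_add_smul_sub {R : ℝ} {N : E → E} {K : NNReal}
    (hN : ∀ x ∈ closedBall (0 : E) R, ‖N x‖ ≤ R) (hfix : ∀ x, ‖x‖ = R → N x = x)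
    (hK : LipschitzOnWith K (fun x => N x - x) (closedBall 0 R)) {t : ℝ} (ht0 : 0 < t)
    (ht1 : t < 1) (htK : t * K < 1) (hR : 0 < R) :
    Set.InjOn (fun x => x + t • (N x - x)) (ball 0 R) ∧
      (fun x => x + t • (N x - x)) '' ball 0 R = ball 0 R := by
  set F : E → E := fun x => x + t • (N x - x) with hF
  let t' : NNReal := ⟨t, ht0.le⟩
  have happ : ApproximatesLinearOn F
      ((ContinuousLinearEquiv.refl ℝ E : E ≃L[ℝ] E) : E →L[ℝ] E) (ball 0 R) (t' * K) := by
    intro x hx y hy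
    have h1 := hK.norm_sub_le (ball_subset_closedBall hx) (ball_subset_closedBall hy)
    have h2 : F x - F y - (x - y) = t • ((N x - x) - (N y - y)) := by
      simp only [hF, smul_sub]; abel
    simp only [ContinuousLinearEquiv.coe_refl, ContinuousLinearMap.id_apply]
    rw [h2, norm_smul, Real.norm_eq_abs, abs_of_pos ht0]
    calc t * _ ≤ t * (K * ‖x - y‖) := by gcongr
      _ = (t' * K : NNReal) * ‖x - y‖ := by rw [NNReal.coe_mul, mul_assoc]; rfl
  have hN1 : t' * K < 1 := by
    rw [← NNReal.coe_lt_coe, NNReal.coe_mul]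
    exact htK
  have hinv : ∀ [Nontrivial E], t' * K < ‖((ContinuousLinearEquiv.refl ℝ E).symm : E →L[ℝ] E)‖₊⁻¹ := by
    intro _
    have : ‖((ContinuousLinearEquiv.refl ℝ E).symm : E →L[ℝ] E)‖₊ = 1 := by
      rw [← NNReal.coe_inj]
      simp
    rw [this]; simpa using hN1
  have hc : Subsingleton E ∨ t' * K < ‖((ContinuousLinearEquiv.refl ℝ E).symm : E →L[ℝ] E)‖₊⁻¹ := by
    rcases subsingleton_or_nontrivial E with h | h
    · exact Or.inl h
    · exact Or.inr hinv
  refine ⟨happ.injOn hc, ?_⟩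
  have hopen : IsOpen (F '' ball 0 R) := by
    have := (happ.toOpenPartialHomeomorph F (ball 0 R) hc isOpen_ball).open_target
    exact this
  have hFle : ∀ x, F x = (1 - t) • x + t • N x := by
    intro x; simp only [hF, smul_sub, sub_smul, one_smul]; abel
  have hmaps : F '' ball 0 R ⊆ ball 0 R := by
    rintro _ ⟨x, hx, rfl⟩
    rw [mem_ball_zero_iff] at hx ⊢
    rw [hFle]
    have h1 := hN x (by simpa using hx.le)
    calc ‖(1 - t) • x + t • N x‖ ≤ (1 - t) * ‖x‖ + t * ‖N x‖ := by
          refine (norm_add_le _ _).trans ?_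
          rw [norm_smul, norm_smul, Real.norm_eq_abs, Real.norm_eq_abs, abs_of_pos ht0,
            abs_of_pos (by linarith)]
      _ < R := by nlinarith
  have hcontF : ContinuousOn F (closedBall 0 R) :=
    continuousOn_id.add (hK.continuousOn.const_smul t)
  -- The image is relatively closed in the ball: a limit point comes from the compact closed ball,
  -- and not from the sphere, which `F` fixes. Being open too, the image is the whole connected
  -- ball.
  have hcl : closure (F '' ball 0 R) ∩ ball 0 R ⊆ F '' ball 0 R := by
    rintro y ⟨hy, hyb⟩
    have hcomp : IsCompact (F '' closedBall 0 R) := (isCompact_closedBall 0 R).image_of_continuousOn hcontF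
    have : y ∈ F '' closedBall 0 R :=
      closure_minimal (Set.image_mono ball_subset_closedBall) hcomp.isClosed hy
    obtain ⟨x, hx, rfl⟩ := this
    rcases (mem_closedBall_zero_iff.1 hx).lt_or_eq with h | h
    · exact ⟨x, by simpa using h, rfl⟩
    · exfalso
      have : F x = x := by simp [hF, hfix x h]
      rw [this, mem_ball_zero_iff] at hyb
      exact hyb.ne h
  refine hmaps.antisymm ?_
  refine IsPreconnected.subset_of_closure_inter_subset (convex_ball (0:E) R).isPreconnected hopen ?_ hcl
  exact ⟨F 0, hmaps ⟨0, by simpa using hR, rfl⟩, 0, by simpa using hR, rfl⟩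

/-- There is no `C^1` retraction of a ball onto its boundary. -/
theorem false_of_contDiff_retraction {R : ℝ} (hR : 0 < R) {N : E → E} (hN : ContDiff ℝ 1 N)
    (hnorm : ∀ x, ‖N x‖ = R) (hfix : ∀ x, ‖x‖ = R → N x = x) [Nontrivial E]: False := by
  borelize E
  let μ : Measure E := volume
  set g : E → E := fun x => N x - x with hg
  have hgC : ContDiff ℝ 1 g := hN.sub contDiff_id
  have hgd : ∀ x, HasFDerivAt g (fderiv ℝ g x) x := fun x =>
    (hgC.differentiable one_ne_zero x).hasFDerivAt
  have hg' : Continuous (fderiv ℝ g) := hgC.continuous_fderiv one_ne_zero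
  obtain ⟨C, hC⟩ := (isCompact_closedBall (0 : E) R).exists_bound_of_continuousOn hg'.continuousOn
  let K : NNReal := ⟨max C 0, le_max_right _ _⟩
  have hCK : ∀ x ∈ closedBall (0 : E) R, ‖fderiv ℝ g x‖ ≤ K := fun x hx =>
    (hC x hx).trans (le_max_left _ _)
  have hLip : LipschitzOnWith K g (closedBall 0 R) :=
    (convex_closedBall 0 R).lipschitzOnWith_of_nnnorm_fderiv_le
      (fun x _ => (hgd x).differentiableAt) (fun x hx => hCK x hx)
  -- Distinct interpolation nodes, small enough that both `v k < 1` and `v k * K < 1`.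
  let v : ℕ → ℝ := fun k => ((K : ℝ) + 2 + k)⁻¹
  have hv0 : ∀ k, 0 < v k := fun k => by positivity
  have hv1 : ∀ k, v k < 1 := fun k =>
    inv_lt_one_of_one_lt₀ (by have := K.2; have : (0:ℝ) ≤ k := by positivity
                              change 1 < (K:ℝ) + 2 + k; linarith [K.coe_nonneg])
  have hvK : ∀ k, v k * K < 1 := fun k => by
    have : (0:ℝ) ≤ k := by positivity
    rw [inv_mul_lt_one₀ (by positivity)]
    linarith
  have hvinj : Function.Injective v := by
    intro a b hab
    have := inv_injective hab
    simpa using this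
  have hdetpos : ∀ k, ∀ x ∈ ball (0 : E) R,
      0 < (ContinuousLinearMap.id ℝ E + v k • fderiv ℝ g x).det := by
    intro k x hx
    apply ContinuousLinearMap.det_id_add_pos
    rw [norm_smul, Real.norm_eq_abs, abs_of_pos (hv0 k)]
    calc _ ≤ v k * K := by
          have := hCK x (ball_subset_closedBall hx)
          have := (hv0 k).le
          gcongr
      _ < 1 := hvK k
  have hint : ∀ t : ℝ, IntegrableOn
      (fun x => (ContinuousLinearMap.id ℝ E + t • fderiv ℝ g x).det) (ball 0 R) μ := by
    intro t
    have : Continuous (fun x => (ContinuousLinearMap.id ℝ E + t • fderiv ℝ g x).det) :=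
      ContinuousLinearMap.continuous_det.comp (by fun_prop)
    exact (this.continuousOn.integrableOn_compact (isCompact_closedBall 0 R)).mono_set
      ball_subset_closedBall
  -- For small parameters the map is a bijection of the ball with positive Jacobian, so the integral
  -- is the volume.
  have hvol : ∀ k, ∫ x in ball (0 : E) R, (ContinuousLinearMap.id ℝ E + v k • fderiv ℝ g x).det ∂μ
      = μ.real (ball 0 R) := by
    intro k
    obtain ⟨hinj, himg⟩ := image_ball_add_smul_sub (fun x _ => (hnorm x).le) hfix hLip (hv0 k)
      (hv1 k) (hvK k) hR
    have := integral_image_eq_integral_abs_det_fderiv_smul μ measurableSet_ball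
      (f := fun x => x + v k • (N x - x))
      (f' := fun x => ContinuousLinearMap.id ℝ E + v k • fderiv ℝ g x)
      (fun x _ => ((hasFDerivAt_id x).add ((hgd x).const_smul (v k))).hasFDerivWithinAt)
      hinj (fun _ => (1 : ℝ))
    rw [himg] at this
    simp only [integral_const, smul_eq_mul, mul_one, measureReal_restrict_apply_univ] at this
    rw [this]
    refine setIntegral_congr_fun measurableSet_ball fun x hx => ?_
    exact (abs_of_pos (hdetpos k x hx)).symm
  -- Interpolation extends the volume identity to parameter `1`, since the Lagrange basis sums to
  -- `1`.
  have hone : ∫ x in ball (0 : E) R, (ContinuousLinearMap.id ℝ E + fderiv ℝ g x).det ∂μ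
      = μ.real (ball 0 R) := by
    have hexp : ∀ x, (ContinuousLinearMap.id ℝ E + fderiv ℝ g x).det =
        ∑ k ∈ Finset.range (Module.finrank ℝ E + 1),
          (ContinuousLinearMap.id ℝ E + v k • fderiv ℝ g x).det *
          (Lagrange.basis (Finset.range (Module.finrank ℝ E + 1)) v k).eval 1 := fun x =>
      LinearMap.det_id_add_eq_sum hvinj (fderiv ℝ g x : E →ₗ[ℝ] E)
    simp_rw [hexp]
    rw [integral_finsetSum _ fun k _ => (hint (v k)).mul_const _]
    simp_rw [integral_mul_const, hvol]
    rw [← Finset.mul_sum, ← Polynomial.eval_finsetSum, Lagrange.sum_basis hvinj.injOn (by simp)]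
    simp
  -- At parameter `1` the map is `N` itself; its derivative has image orthogonal to `N x ≠ 0`, so it
  -- is singular.
  have hzero : ∀ x, (ContinuousLinearMap.id ℝ E + fderiv ℝ g x).det = 0 := by
    intro x
    have hd : HasFDerivAt N (ContinuousLinearMap.id ℝ E + fderiv ℝ g x) x := by
      have := (hasFDerivAt_id x).add (hgd x)
      convert this using 1
      ext y; simp [hg]
    have hker : ∀ w, inner ℝ (N x) ((ContinuousLinearMap.id ℝ E + fderiv ℝ g x) w) = 0 := by
      intro w
      have h1 := hd.norm_sq
      have h2 : (fun y => ‖N y‖ ^ 2) = fun _ => R ^ 2 := by ext y; rw [hnorm]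
      rw [h2] at h1
      have h3 := h1.unique (hasFDerivAt_const (R ^ 2) x)
      have h4 := DFunLike.congr_fun h3 w
      simpa [← mul_add, ← inner_add_right] using h4
    by_contra hdet
    have hsurj : Function.Surjective (ContinuousLinearMap.id ℝ E + fderiv ℝ g x) := by
      have := (LinearMap.isUnit_iff_range_eq_top _).1
        ((LinearMap.isUnit_iff_isUnit_det _).2 (isUnit_iff_ne_zero.2 hdet))
      exact LinearMap.range_eq_top.1 this
    obtain ⟨w, hw⟩ := hsurj (N x)
    have := hker w
    rw [hw, real_inner_self_eq_norm_sq, hnorm] at this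
    exact (pow_pos hR 2).ne' this
  simp_rw [hzero] at hone
  simp only [integral_zero] at hone
  have : 0 < μ.real (ball (0 : E) R) :=
    ENNReal.toReal_pos (measure_ball_pos μ 0 hR).ne' measure_ball_lt_top.ne
  exact this.ne hone

/-- If `f` had no zero, approximate `f - id` by a `C^1` map `h` with error below `‖f‖` and no larger
support. Then `x + h x` never vanishes and is the identity on the sphere, so rescaling it to length
`R` gives a forbidden retraction. -/
theorem exists_eq_zero_of_eq_self_of_le_norm_aux {f : E → E} (hf : Continuous f) {R : ℝ} (hR : 0 < R)
    (hfix : ∀ x, R ≤ ‖x‖ → f x = x) : ∃ x, f x = 0 := by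
  rcases subsingleton_or_nontrivial E with hE | hE
  · exact ⟨0, Subsingleton.elim _ _⟩
  by_contra! h0
  obtain ⟨h, hC, happ, hsupp⟩ := (hf.sub continuous_id).exists_contDiff_approx 1 (hf.norm)
    (fun x => norm_pos_iff.2 (h0 x))
  have hne : ∀ x, x + h x ≠ 0 := by
    intro x hx
    have h1 := happ x
    have h2 : h x = -x := (neg_eq_of_add_eq_zero_right hx).symm
    rw [dist_eq_norm, h2, Pi.sub_apply, id_eq, neg_sub_left, sub_add_cancel, norm_neg] at h1
    exact h1.false
  have hfix' : ∀ x, ‖x‖ = R → h x = 0 := by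
    intro x hx
    by_contra hx'
    exact hsupp hx' (by simp [hfix x hx.ge])
  refine false_of_contDiff_retraction hR (N := fun x => (R * ‖x + h x‖⁻¹) • (x + h x)) ?_ ?_ ?_
  · have h1 : ContDiff ℝ 1 (fun x => x + h x) := contDiff_id.add hC
    exact (contDiff_const.mul ((h1.norm ℝ hne).inv fun x => norm_ne_zero_iff.2 (hne x))).smul h1
  · intro x
    rw [norm_smul, Real.norm_eq_abs, abs_of_nonneg (by positivity), mul_assoc,
      inv_mul_cancel₀ (norm_ne_zero_iff.2 (hne x)), mul_one]
  · intro x hx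
    simp only [hfix' x hx, add_zero, hx, mul_inv_cancel₀ hR.ne', one_smul]

end Retraction

/-- A continuous self-map of a finite-dimensional space that is the identity outside a bounded
set has a zero. -/
theorem exists_eq_zero_of_eq_self_of_le_norm {V : Type*} [NormedAddCommGroup V] [NormedSpace ℝ V]
    [FiniteDimensional ℝ V] {f : V → V} (hf : Continuous f) {R : ℝ}
    (hfix : ∀ x, R ≤ ‖x‖ → f x = x) : ∃ x, f x = 0 := by
  let e : V ≃L[ℝ] EuclideanSpace ℝ (Fin (Module.finrank ℝ V)) := toEuclidean
  obtain ⟨x, hx⟩ := exists_eq_zero_of_eq_self_of_le_norm_aux (f := fun y => e (f (e.symm y)))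
    (by fun_prop) (R := ‖e.toContinuousLinearMap‖ * |R| + 1) (by positivity) (fun x hx => by
      have : R ≤ ‖e.symm x‖ := by
        by_contra! hlt
        have h1 := e.toContinuousLinearMap.le_opNorm (e.symm x)
        simp only [ContinuousLinearEquiv.coe_coe, ContinuousLinearEquiv.apply_symm_apply] at h1
        have h2 : ‖e.toContinuousLinearMap‖ * ‖e.symm x‖ ≤ ‖e.toContinuousLinearMap‖ * |R| := by
          gcongr
          exact hlt.le.trans (le_abs_self R)
        linarith
      simp [hfix _ this])
  exact ⟨e.symm x, by simpa using hx⟩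

/-! ### Spheres mapped to contractible spaces -/

open Metric

section Extension

variable {V : Type*} [NormedAddCommGroup V] [NormedSpace ℝ V] [FiniteDimensional ℝ V]

/-- A map from the unit sphere to a contractible space extends to the whole vector space, and
the extension may be chosen constant on rays outside the unit ball. -/
theorem exists_continuous_extension_of_contractibleSpace {X : Type*} [TopologicalSpace X]
    [ContractibleSpace X] {g : sphere (0 : V) 1 → X} (hg : Continuous g) :
    ∃ G : V → X, Continuous G ∧
      ∀ (z : sphere (0 : V) 1) (r : ℝ), 1 ≤ r → G (r • (z : V)) = g z := by
  obtain ⟨y₀, ⟨F⟩⟩ := id_nullhomotopic X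
  rcases subsingleton_or_nontrivial V with hV | hV
  · refine ⟨fun _ => y₀, continuous_const, fun z => ?_⟩
    have := z.2
    rw [mem_sphere_zero_iff_norm, Subsingleton.elim (z : V) 0, norm_zero] at this
    exact absurd this zero_ne_one
  obtain ⟨e₀, he₀⟩ := exists_norm_eq V zero_le_one
  have hmem : ∀ y : V, y ≠ 0 → ‖y‖⁻¹ • y ∈ sphere (0 : V) 1 := fun y hy => by
    rw [mem_sphere_zero_iff_norm, norm_smul, norm_inv, norm_norm,
      inv_mul_cancel₀ (norm_ne_zero_iff.2 hy)]
  classical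
  let s : V → sphere (0 : V) 1 := fun y =>
    if h : y = 0 then ⟨e₀, by simpa using he₀⟩ else ⟨‖y‖⁻¹ • y, hmem y h⟩
  have hs : ∀ y : V, y ≠ 0 → (s y : V) = ‖y‖⁻¹ • y := fun y hy => by simp [s, hy]
  have hsc : ∀ y : V, y ≠ 0 → ContinuousAt s y := by
    intro y hy
    rw [Topology.IsInducing.subtypeVal.continuousAt_iff]
    have : ContinuousAt (fun y : V => ‖y‖⁻¹ • y) y :=
      (continuousAt_id.norm.inv₀ (norm_ne_zero_iff.2 hy)).smul continuousAt_id
    refine this.congr ?_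
    filter_upwards [isOpen_ne.mem_nhds hy] with x hx using (hs x hx).symm
  -- Contraction time: `0` on and outside the unit sphere, `1` at the centre.
  let τ : V → unitInterval := fun y => Set.projIcc 0 1 zero_le_one (1 - ‖y‖)
  have hτ : Continuous τ := continuous_projIcc.comp (by fun_prop)
  refine ⟨fun y => F (τ y, g (s y)), ?_, ?_⟩
  · rw [continuous_iff_continuousAt]
    intro y
    by_cases hy : y = 0
    · subst hy
      have h1 : τ 0 = 1 := by simp [τ]
      rw [ContinuousAt, h1, F.apply_one]
      rw [_root_.tendsto_nhds]
      intro U hU hyU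
      -- The direction `s` is not continuous at `0`, but near time `1` the contraction is close to
      -- `y₀` uniformly over the compact sphere.
      have hcomp : IsCompact (Set.univ : Set (sphere (0 : V) 1)) := isCompact_univ
      have key : ∀ᶠ t in nhds (1 : unitInterval), ∀ w ∈ (Set.univ : Set (sphere (0 : V) 1)),
          F (t, g w) ∈ U := by
        refine hcomp.eventually_forall_of_forall_eventually fun w _ => ?_
        have hc : Continuous (fun p : unitInterval × sphere (0 : V) 1 => F (p.1, g p.2)) := by
          fun_prop
        refine hc.continuousAt.eventually_mem (hU.mem_nhds ?_)
        simpa using hyU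
      have := hτ.continuousAt (x := 0)
      rw [ContinuousAt, h1] at this
      filter_upwards [this.eventually key] with z hz using hz _ trivial
    · exact F.continuous.continuousAt.comp
        (hτ.continuousAt.prodMk (hg.continuousAt.comp (hsc y hy)))
  · intro z r hr
    have hz : ‖(z : V)‖ = 1 := by simp
    have hr0 : 0 < r := by linarith
    have hn : ‖r • (z : V)‖ = r := by rw [norm_smul, hz, mul_one, Real.norm_eq_abs, abs_of_pos hr0]
    have hne : r • (z : V) ≠ 0 := by
      rw [← norm_ne_zero_iff, hn]; exact hr0.ne'
    have h1 : τ (r • (z : V)) = 0 := by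
      simp only [τ, hn]
      exact Set.projIcc_of_le_left _ (by linarith)
    have h2 : s (r • (z : V)) = z := by
      apply Subtype.ext
      rw [hs _ hne, hn, smul_smul, inv_mul_cancel₀ hr0.ne', one_smul]
    simp only [h1, h2]
    simp

/-- A sphere mapped to a contractible space cannot be followed by a nowhere vanishing map that
never points in the direction opposite to the position vector. -/
theorem exists_eq_zero_or_eq_neg_smul {Y : Type*} [TopologicalSpace Y] [ContractibleSpace Y]
    {g : sphere (0 : V) 1 → Y} (hg : Continuous g) {Θ : Y → V} (hΘ : Continuous Θ) :
    (∃ y, Θ y = 0) ∨ ∃ (z : sphere (0 : V) 1) (c : ℝ), 0 < c ∧ Θ (g z) = -(c • (z : V)) := by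
  by_contra! hcon
  obtain ⟨h0, hop⟩ := hcon
  obtain ⟨G, hG, hGg⟩ := exists_continuous_extension_of_contractibleSpace hg
  -- Interpolates from `Θ ∘ G` on the unit ball to the identity beyond radius `2`. A zero in
  -- between, where `G` is constant on rays, makes `Θ (g z)` a negative multiple of `z`.
  let χ : V → ℝ := fun z => max 0 (min 1 (‖z‖ - 1))
  obtain ⟨z, hz⟩ := exists_eq_zero_of_eq_self_of_le_norm
    (f := fun z => (1 - χ z) • Θ (G z) + χ z • z) (by fun_prop) (R := 2) (fun z hz => by
      have : χ z = 1 := by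
        simp only [χ]
        rw [min_eq_left (by linarith), max_eq_right zero_le_one]
      simp [this])
  rcases le_or_gt ‖z‖ 1 with h1 | h1
  · have : χ z = 0 := by
      simp only [χ]
      exact max_eq_left ((min_le_right _ _).trans (by linarith))
    simp only [this, sub_zero, one_smul, zero_smul, add_zero] at hz
    exact h0 _ hz
  · have hz0 : ‖z‖ ≠ 0 := by positivity
    have hw : ‖z‖⁻¹ • z ∈ sphere (0 : V) 1 := by
      rw [mem_sphere_zero_iff_norm, norm_smul, norm_inv, norm_norm, inv_mul_cancel₀ hz0]
    have hzw : z = ‖z‖ • ((⟨‖z‖⁻¹ • z, hw⟩ : sphere (0 : V) 1) : V) := by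
      simp [smul_smul, hz0]
    have hGz : G z = g ⟨‖z‖⁻¹ • z, hw⟩ := by
      conv_lhs => rw [hzw]
      exact hGg _ _ h1.le
    have hχ0 : 0 < χ z := lt_max_of_lt_right (lt_min one_pos (by linarith))
    have hχ1 : χ z ≠ 1 := by
      intro h
      rw [h, sub_self, zero_smul, zero_add, one_smul] at hz
      rw [hz, norm_zero] at h1
      linarith
    have hχ2 : χ z ≤ 1 := max_le zero_le_one (min_le_left _ _)
    have hχ3 : 0 < 1 - χ z := by
      rcases hχ2.lt_or_eq with h | h
      · linarith
      · exact absurd h hχ1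
    refine hop ⟨‖z‖⁻¹ • z, hw⟩ ((1 - χ z)⁻¹ * χ z * ‖z‖) (by positivity) ?_
    rw [← hGz]
    have h2 := eq_neg_of_add_eq_zero_left hz
    rw [← inv_smul_smul₀ hχ3.ne' (Θ (G z)), h2]
    simp only [smul_neg, smul_smul]
    rw [mul_assoc, mul_inv_cancel₀ hz0, mul_one]

/-- If `X ⊆ Y` are contractible and `j` is a cell of `Y` with boundary in `X`, then a map
`(u, σ)` to `V × ℝ` that is radial on the boundary of the cell, and whose last coordinate is
nonnegative on `X` and nonpositive on the cell, has a zero. -/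
theorem exists_eq_zero_of_contractibleSpace_of_cell {X Y : Type*} [TopologicalSpace X]
    [TopologicalSpace Y] [ContractibleSpace X] [ContractibleSpace Y] {i : X → Y}
    (hi : Continuous i) {j : V → Y} (hj : Continuous j) {j' : sphere (0 : V) 1 → X}
    (hj' : Continuous j') (hij : ∀ z, i (j' z) = j z) {u : Y → V} (hu : Continuous u)
    {σ : Y → ℝ} (hσ : Continuous σ) (hσi : ∀ x, 0 ≤ σ (i x)) (hσj : ∀ x, σ (j x) ≤ 0)
    (hrad : ∀ (z : sphere (0 : V) 1) (c : ℝ), 0 < c → u (j z) ≠ -(c • (z : V))) :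
    ∃ y, u y = 0 ∧ σ y = 0 := by
  obtain ⟨C, hC, hCj⟩ := exists_continuous_extension_of_contractibleSpace hj'
  -- The norm of `V × ℝ` is the maximum norm, so the equator is exactly the unit sphere of `V`.
  -- There the cell `j` and the filling `C` of its boundary in `X` glue to one sphere in `Y`.
  have hnorm : ∀ z : sphere (0 : V × ℝ) 1, (z : V × ℝ).2 = 0 →
      (z : V × ℝ).1 ∈ sphere (0 : V) 1 := by
    intro z hz
    have h1 : ‖(z : V × ℝ)‖ = 1 := by simp
    rw [Prod.norm_def, hz, norm_zero, max_eq_left (norm_nonneg _)] at h1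
    simpa using h1
  have hg : Continuous fun z : sphere (0 : V × ℝ) 1 =>
      if (z : V × ℝ).2 ≤ 0 then j (z : V × ℝ).1 else i (C (z : V × ℝ).1) := by
    refine Continuous.if_le (by fun_prop) (by fun_prop) (by fun_prop) (by fun_prop) ?_
    intro z hz
    have := hCj ⟨_, hnorm z hz⟩ 1 le_rfl
    rw [one_smul] at this
    rw [this, hij]
  rcases exists_eq_zero_or_eq_neg_smul hg (Θ := fun y => (u y, σ y)) (by fun_prop) with
    ⟨y, hy⟩ | ⟨z, c, hc, hz⟩
  · exact ⟨y, congrArg Prod.fst hy, congrArg Prod.snd hy⟩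
  · exfalso
    have hz1 := congrArg Prod.fst hz
    have hz2 := congrArg Prod.snd hz
    simp only [Prod.fst_neg, Prod.smul_fst, Prod.snd_neg, Prod.smul_snd, smul_eq_mul] at hz1 hz2
    split_ifs at hz1 hz2 with h
    · have h3 := hσj (z : V × ℝ).1
      have h4 : (z : V × ℝ).2 = 0 := by nlinarith
      exact hrad ⟨_, hnorm z h4⟩ c hc hz1
    · have h3 := hσi (C (z : V × ℝ).1)
      nlinarith

end Extension

/-! ### Straight-line homotopies -/

section Segments

theorem ContinuousMap.homotopic_of_segment_subset {X E : Type*} [TopologicalSpace X]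
    [AddCommGroup E] [Module ℝ E] [TopologicalSpace E] [IsTopologicalAddGroup E]
    [ContinuousSMul ℝ E] {s : Set E} {f g : C(X, s)}
    (h : ∀ x, segment ℝ (f x : E) (g x) ⊆ s) : f.Homotopic g :=
  ⟨{ toFun := fun p => ⟨(1 - (p.1 : ℝ)) • (f p.2 : E) + (p.1 : ℝ) • (g p.2 : E),
        h p.2 ⟨1 - (p.1 : ℝ), p.1, sub_nonneg.2 p.1.2.2, p.1.2.1, by ring, rfl⟩⟩
     continuous_toFun := by fun_prop
     map_zero_left := fun x => by simp
     map_one_left := fun x => by simp }⟩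

/-- Maps whose composites are joined to the identity by straight lines are homotopy inverse. -/
theorem nonempty_homotopyEquiv_of_segment_subset {E F : Type*}
    [AddCommGroup E] [Module ℝ E] [TopologicalSpace E] [IsTopologicalAddGroup E]
    [ContinuousSMul ℝ E] [AddCommGroup F] [Module ℝ F] [TopologicalSpace F]
    [IsTopologicalAddGroup F] [ContinuousSMul ℝ F] {s : Set E} {t : Set F} {φ : E → F} {ψ : F → E}
    (hφ : ContinuousOn φ s) (hψ : ContinuousOn ψ t) (hst : Set.MapsTo φ s t)
    (hts : Set.MapsTo ψ t s) (hs : ∀ x ∈ s, segment ℝ (ψ (φ x)) x ⊆ s)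
    (ht : ∀ y ∈ t, segment ℝ (φ (ψ y)) y ⊆ t) :
    Nonempty (ContinuousMap.HomotopyEquiv s t) :=
  ⟨{ toFun := ⟨hst.restrict φ s t, hφ.mapsToRestrict hst⟩
     invFun := ⟨hts.restrict ψ t s, hψ.mapsToRestrict hts⟩
     left_inv := ContinuousMap.homotopic_of_segment_subset fun x => hs x x.2
     right_inv := ContinuousMap.homotopic_of_segment_subset fun y => ht y y.2 }⟩

end Segments

/-! ### Supports of points of the realization -/

section Realization

variable {E : Type*} [Fintype E]

theorem mem_geomRealization_iff {K : PreAbstractSimplicialComplex E} {x : E → ℝ} :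
    x ∈ geomRealization K ↔ ∃ F ∈ K.faces, x ∈ openSimplex F := by
  simp [geomRealization]

theorem mem_geomRealization_of_support_subset {K : PreAbstractSimplicialComplex E} {x : E → ℝ}
    (hx : x ∈ stdSimplex ℝ E) {F : Finset E} (hF : F ∈ K.faces) (h : ∀ e, x e ≠ 0 → e ∈ F) :
    x ∈ geomRealization K := by
  classical
  refine mem_geomRealization_iff.2 ⟨Finset.univ.filter fun e => x e ≠ 0, ?_, hx, by simp⟩
  refine (K.isRelLowerSet_faces hF).2 (fun e he => h e (by simpa using he)) ?_
  by_contra hne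
  rw [Finset.not_nonempty_iff_eq_empty, Finset.filter_eq_empty_iff] at hne
  have h1 : ∑ e, x e = 0 := Finset.sum_eq_zero fun e he => by simpa using hne he
  rw [hx.2] at h1
  exact one_ne_zero h1

theorem openSimplex_eq_of_subset_support {K : PreAbstractSimplicialComplex E} {x : E → ℝ}
    (hx : x ∈ geomRealization K) {F : Finset E} (hF : IsFacet K F) (h : ∀ e ∈ F, x e ≠ 0) :
    x ∈ openSimplex F := by
  obtain ⟨F', hF', hx', hs⟩ := mem_geomRealization_iff.1 hx
  have : F = F' := Maximal.eq_of_le (P := fun G => G ∈ K.faces) hF hF' fun e he => (hs e).1 (h e he)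
  exact ⟨hx', this ▸ hs⟩

theorem eq_of_mem_openSimplex_of_support_subset {K : PreAbstractSimplicialComplex E} {x : E → ℝ}
    {F F' : Finset E} (hF : F ∈ K.faces) (hF' : IsFacet K F') (hx : x ∈ openSimplex F')
    (h : ∀ e, x e ≠ 0 → e ∈ F) : F' = F :=
  Maximal.eq_of_le (P := fun G => G ∈ K.faces) hF' hF fun e he => h e ((hx.2 e).2 he)

end Realization

/-! ### A closed simplex as a radially parametrized ball -/

section Cell

variable {E : Type*} (F : Finset E)

/-- The coordinate vectors on `F` with sum zero. -/
abbrev sumZero : Submodule ℝ (F → ℝ) :=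
  LinearMap.ker (∑ e : F, LinearMap.proj e : (F → ℝ) →ₗ[ℝ] ℝ)

theorem mem_sumZero {x : F → ℝ} : x ∈ sumZero F ↔ ∑ e, x e = 0 := by
  simp [sumZero, LinearMap.mem_ker]

/-- Unnormalized barycentric coordinates of a radial parametrization of the simplex `F`. -/
noncomputable def cellWeight {F : Finset E} (hF : (Finset.univ : Finset F).Nonempty)
    (x : sumZero F) (e : F) : ℝ :=
  x.1 e - Finset.univ.inf' hF x.1 + max 0 (1 - ‖x‖)

variable {F} (hF : (Finset.univ : Finset F).Nonempty)

theorem continuous_cellWeight (e : F) : Continuous fun x => cellWeight hF x e := by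
  unfold cellWeight
  have : Continuous fun x : sumZero F => Finset.univ.inf' hF fun e => x.1 e :=
    Continuous.finset_inf'_apply hF fun i _ => (continuous_apply i).comp continuous_subtype_val
  exact (((continuous_apply e).comp continuous_subtype_val).sub this).add (by fun_prop)

theorem cellWeight_nonneg (x : sumZero F) (e : F) : 0 ≤ cellWeight hF x e :=
  add_nonneg (sub_nonneg.2 (Finset.inf'_le _ (Finset.mem_univ e))) (le_max_left _ _)

/-- If all weights vanished, `x` would be constant, hence `0` by its zero sum; but at `0` every
weight is `1`. -/
theorem sum_cellWeight_pos (x : sumZero F) : 0 < ∑ e, cellWeight hF x e := by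
  refine (Finset.sum_nonneg fun e _ => cellWeight_nonneg hF x e).lt_of_ne' fun h0 => ?_
  rw [Finset.sum_eq_zero_iff_of_nonneg fun e _ => cellWeight_nonneg hF x e] at h0
  set c := Finset.univ.inf' hF x.1 - max 0 (1 - ‖x‖) with hc
  have h1 : ∀ e, x.1 e = c := fun e => by
    have := h0 e (Finset.mem_univ e)
    rw [cellWeight] at this
    linarith
  have h2 := (mem_sumZero F).1 x.2
  simp only [h1, Finset.sum_const, nsmul_eq_mul, mul_eq_zero, Nat.cast_eq_zero,
    Finset.card_eq_zero, hF.ne_empty, false_or] at h2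
  have hx : x = 0 := by
    ext e
    rw [h1, h2]; rfl
  obtain ⟨e, he⟩ := hF
  have h3 : x.1 e - Finset.univ.inf' ⟨e, he⟩ x.1 + max 0 (1 - ‖x‖) = 0 := h0 e he
  rw [hx, norm_zero] at h3
  have h4 : Finset.univ.inf' ⟨e, he⟩ ((0 : sumZero F) : F → ℝ) = 0 := by
    refine Finset.inf'_eq_of_forall _ _ fun _ _ => rfl
  rw [h4] at h3
  simp at h3

theorem exists_cellWeight_eq_zero (x : sumZero F) (hx : ‖x‖ = 1) : ∃ e, cellWeight hF x e = 0 := by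
  obtain ⟨e, -, he⟩ := Finset.exists_mem_eq_inf' hF x.1
  exact ⟨e, by rw [cellWeight, he, hx]; simp⟩

/-- The deviation of the `F`-coordinates from their mean. -/
noncomputable def deviation (F : Finset E) (y : E → ℝ) : sumZero F :=
  ⟨fun e => y e - (∑ e' : F, y e') / (Finset.univ : Finset F).card, by
    rw [mem_sumZero, Finset.sum_sub_distrib, Finset.sum_const, nsmul_eq_mul]
    rcases (Finset.univ : Finset F).eq_empty_or_nonempty with h | h
    · simp [h]
    · have : ((Finset.univ : Finset F).card : ℝ) ≠ 0 := by
        exact_mod_cast (Finset.card_pos.2 h).ne'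
      rw [mul_div_cancel₀ _ this, sub_self]⟩

theorem continuous_deviation : Continuous (deviation F) := by
  unfold deviation
  fun_prop

variable [DecidableEq E]

/-- A radial parametrization of the simplex `F` by the unit ball of `sumZero F`. -/
noncomputable def cellMap (x : sumZero F) (e : E) : ℝ :=
  if h : e ∈ F then cellWeight hF x ⟨e, h⟩ / ∑ e', cellWeight hF x e' else 0

theorem continuous_cellMap : Continuous (cellMap hF) := by
  refine continuous_pi fun e => ?_
  unfold cellMap
  split_ifs with h
  · exact (continuous_cellWeight hF _).div
      (continuous_finsetSum _ fun e _ => continuous_cellWeight hF e)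
      fun x => (sum_cellWeight_pos hF x).ne'
  · exact continuous_const

theorem cellMap_support (x : sumZero F) (e : E) (h : cellMap hF x e ≠ 0) : e ∈ F := by
  by_contra he
  exact h (by simp [cellMap, he])

/-- Subtracting the mean removes the constant added in `cellWeight` and leaves a positive multiple
of `x`. This makes the cell radial. -/
theorem deviation_cellMap (x : sumZero F) :
    deviation F (cellMap hF x) = (∑ e, cellWeight hF x e)⁻¹ • x := by
  have hc : ((Finset.univ : Finset F).card : ℝ) ≠ 0 := by
    exact_mod_cast (Finset.card_pos.2 hF).ne'
  have h0 := (mem_sumZero F).1 x.2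
  have hs := (sum_cellWeight_pos hF x).ne'
  have hsum : ∑ e' : F, cellMap hF x e' = 1 := by
    simp only [cellMap, Finset.coe_mem, dif_pos, Subtype.coe_eta]
    rw [← Finset.sum_div, div_self hs]
  have hs' : ∑ e, cellWeight hF x e = (Finset.univ : Finset F).card *
      (max 0 (1 - ‖x‖) - Finset.univ.inf' hF x.1) := by
    simp only [cellWeight, Finset.sum_add_distrib, Finset.sum_sub_distrib, h0, Finset.sum_const,
      nsmul_eq_mul]
    ring
  ext e
  simp only [deviation, hsum, SetLike.val_smul, Pi.smul_apply, smul_eq_mul]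
  simp only [cellMap, Finset.coe_mem, dif_pos, Subtype.coe_eta]
  rw [div_sub_div _ _ hs hc, inv_mul_eq_div, div_eq_div_iff (mul_ne_zero hs hc) hs, cellWeight]
  rw [hs']
  ring

variable [Fintype E]

theorem cellMap_mem_stdSimplex (x : sumZero F) : cellMap hF x ∈ stdSimplex ℝ E := by
  refine ⟨fun e => ?_, ?_⟩
  · unfold cellMap
    split_ifs
    · exact div_nonneg (cellWeight_nonneg hF x _) (sum_cellWeight_pos hF x).le
    · exact le_rfl
  · rw [← Finset.sum_subset (Finset.subset_univ F) fun e _ he => by simp [cellMap, he],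
      ← Finset.sum_coe_sort]
    simp only [cellMap, Finset.coe_mem, dif_pos, Subtype.coe_eta]
    rw [← Finset.sum_div, div_self (sum_cellWeight_pos hF x).ne']

end Cell

/-! ### Generating sets form an antichain -/

section GeneratingSets

variable {E : Type*} [Fintype E] [DecidableEq E]

/-- A set of generating facets is not properly contained in another one. -/
theorem IsGeneratingSet.eq_of_subset {K : PreAbstractSimplicialComplex E}
    {S S' : Set (Finset E)} (hS : IsGeneratingSet K S) (hS' : IsGeneratingSet K S')
    (hsub : S ⊆ S') : S = S' := by
  refine hsub.antisymm fun F hFS' => ?_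
  by_contra hFS
  have hFK := hS'.1 F hFS'
  have hne : F.Nonempty := (K.isRelLowerSet_faces hFK.prop).1
  have hF : (Finset.univ : Finset F).Nonempty := by
    obtain ⟨e, he⟩ := hne
    exact ⟨⟨e, he⟩, Finset.mem_univ _⟩
  let X := ↥(geomRealization K \ ⋃ F ∈ S', openSimplex F)
  let Y := ↥(geomRealization K \ ⋃ F ∈ S, openSimplex F)
  have : ContractibleSpace X := hS'.2
  have : ContractibleSpace Y := hS.2
  have hXY : geomRealization K \ ⋃ F ∈ S', openSimplex F ⊆
      geomRealization K \ ⋃ F ∈ S, openSimplex F :=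
    Set.sdiff_subset_sdiff_right (Set.biUnion_subset_biUnion_left hsub)
  have hjK : ∀ x, cellMap hF x ∈ geomRealization K := fun x =>
    mem_geomRealization_of_support_subset (cellMap_mem_stdSimplex hF x) hFK.prop
      (cellMap_support hF x)
  have hjeq : ∀ x, ∀ F', IsFacet K F' → cellMap hF x ∈ openSimplex F' → F' = F := fun x F' h h' =>
    eq_of_mem_openSimplex_of_support_subset hFK.prop h h' (cellMap_support hF x)
  let j : sumZero F → Y := fun x => ⟨cellMap hF x, hjK x, fun h => by
    simp only [Set.mem_iUnion] at h
    obtain ⟨F', hF', h⟩ := h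
    exact hFS (hjeq x F' (hS.1 F' hF') h ▸ hF')⟩
  let j' : Metric.sphere (0 : sumZero F) 1 → X := fun z => ⟨cellMap hF z, hjK z, fun h => by
    simp only [Set.mem_iUnion] at h
    obtain ⟨F', hF', h⟩ := h
    obtain rfl := hjeq z F' (hS'.1 F' hF') h
    obtain ⟨e, he⟩ := exists_cellWeight_eq_zero hF z (by simp)
    exact (h.2 e).2 e.2 (by simp [cellMap, he])⟩
  -- The simplex `F` is a cell of the larger space `Y` whose boundary lies in the contractible
  -- subspace `X`. The product in `σ` vanishes on `X`, where some `F`-coordinate is zero; the outer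
  -- sum vanishes on the cell.
  obtain ⟨y, hy1, hy2⟩ := exists_eq_zero_of_contractibleSpace_of_cell (X := X) (Y := Y)
    (i := Set.inclusion hXY) (continuous_inclusion hXY)
    (j := j) ((continuous_cellMap hF).subtype_mk _)
    (j' := j') (((continuous_cellMap hF).comp continuous_subtype_val).subtype_mk _)
    (fun z => rfl) (u := fun y => deviation F y) (continuous_deviation.comp continuous_subtype_val)
    (σ := fun y => ∑ e ∈ Fᶜ, y.1 e - ∏ e ∈ F, y.1 e)
    ((by fun_prop : Continuous fun y : E → ℝ => ∑ e ∈ Fᶜ, y e - ∏ e ∈ F, y e).comp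
      continuous_subtype_val)
    (by
      rintro ⟨x, hxK, hx⟩
      obtain ⟨-, -, hstd, -⟩ := mem_geomRealization_iff.1 hxK
      have h1 : 0 ≤ ∑ e ∈ Fᶜ, x e := Finset.sum_nonneg fun e _ => hstd.1 e
      have h2 : ∏ e ∈ F, x e = 0 := by
        by_contra h
        rw [Finset.prod_eq_zero_iff] at h
        push Not at h
        refine hx ?_
        simp only [Set.mem_iUnion]
        exact ⟨F, hFS', openSimplex_eq_of_subset_support hxK hFK h⟩
      change 0 ≤ ∑ e ∈ Fᶜ, x e - ∏ e ∈ F, x e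
      rw [h2, sub_zero]
      exact h1)
    (by
      intro x
      have h1 : ∑ e ∈ Fᶜ, cellMap hF x e = 0 := Finset.sum_eq_zero fun e he => by
        simp [cellMap, Finset.mem_compl.1 he]
      have h2 : 0 ≤ ∏ e ∈ F, cellMap hF x e :=
        Finset.prod_nonneg fun e _ => (cellMap_mem_stdSimplex hF x).1 e
      change ∑ e ∈ Fᶜ, cellMap hF x e - ∏ e ∈ F, cellMap hF x e ≤ 0
      rw [h1, zero_sub]
      exact neg_nonpos.2 h2)
    (by
      intro z c hc h
      change deviation F (cellMap hF z) = _ at h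
      rw [deviation_cellMap, eq_neg_iff_add_eq_zero, ← add_smul] at h
      have h1 := sum_cellWeight_pos hF (z : sumZero F)
      rcases smul_eq_zero.1 h with h | h
      · have := inv_pos.2 h1
        linarith
      · have h2 : ‖(z : sumZero F)‖ = 1 := by simp
        rw [h, norm_zero] at h2
        exact zero_ne_one h2)
  obtain ⟨⟨y, hyK, hyS⟩, rfl⟩ : ∃ y' : Y, y' = y := ⟨y, rfl⟩
  obtain ⟨-, -, hstd, -⟩ := mem_geomRealization_iff.1 hyK
  replace hy1 : deviation F y = 0 := hy1
  replace hy2 : ∑ e ∈ Fᶜ, y e - ∏ e ∈ F, y e = 0 := hy2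
  set a := (∑ e' : F, y e') / (Finset.univ : Finset F).card
  have ha : ∀ e ∈ F, y e = a := fun e he => by
    have := congrFun (congrArg Subtype.val hy1) ⟨e, he⟩
    exact sub_eq_zero.1 this
  have hsum := Finset.sum_add_sum_compl F y
  rw [hstd.2] at hsum
  -- At the zero all `F`-coordinates equal `a`. For `a = 0` all mass lies outside `F`; otherwise the
  -- point is interior to `F` and the product is positive. Either way `σ ≠ 0`.
  by_cases ha0 : a = 0
  · have h1 : ∑ e ∈ F, y e = 0 := Finset.sum_eq_zero fun e he => by rw [ha e he, ha0]
    obtain ⟨e, he⟩ := hne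
    have h2 : ∏ e ∈ F, y e = 0 := Finset.prod_eq_zero he (by rw [ha e he, ha0])
    linarith
  · have h1 : y ∈ openSimplex F :=
      openSimplex_eq_of_subset_support hyK hFK fun e he => by rwa [ha e he]
    have h2 : ∑ e ∈ Fᶜ, y e = 0 := Finset.sum_eq_zero fun e he => by
      by_contra h
      exact Finset.mem_compl.1 he ((h1.2 e).1 h)
    have h3 : 0 < ∏ e ∈ F, y e := Finset.prod_pos fun e he =>
      (hstd.1 e).lt_of_ne' ((h1.2 e).2 he)
    linarith

end GeneratingSets

/-! ### Combinatorics of forests in a labelled basic tree -/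

theorem isAcyclicEdgeSet_of_lt {V : Type*} {A : Set (V × V)} (f : V → ℕ)
    (h : ∀ a b, (a, b) ∈ A → f a < f b) : IsAcyclicEdgeSet A := by
  have key : ∀ x y, Relation.TransGen (fun a b => (a, b) ∈ A) x y → f x < f y := by
    intro x y hxy
    induction hxy with
    | single hab => exact h _ _ hab
    | tail _ hab ih => exact ih.trans (h _ _ hab)
  exact fun x hx => (key x x hx).false

/-- Adding edges that end in sinks creates no directed cycle. -/
theorem IsAcyclicEdgeSet.union_of_sinks {V : Type*} {A B : Set (V × V)} (hA : IsAcyclicEdgeSet A)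
    (hB : ∀ a b c, (a, b) ∈ B → (b, c) ∉ A ∪ B) : IsAcyclicEdgeSet (A ∪ B) := by
  have key : ∀ x y, Relation.TransGen (fun a b => (a, b) ∈ A ∪ B) x y →
      Relation.TransGen (fun a b => (a, b) ∈ A) x y ∨ ∀ c, (y, c) ∉ A ∪ B := by
    intro x y hxy
    induction hxy with
    | single hab =>
      rcases hab with h | h
      · exact Or.inl (.single h)
      · exact Or.inr fun c => hB _ _ c h
    | tail _ hab ih =>
      rcases ih with ih | ih
      · rcases hab with h | h
        · exact Or.inl (ih.tail h)
        · exact Or.inr fun c => hB _ _ c h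
      · exact absurd hab (ih _)
  intro x hx
  rcases key x x hx with h | h
  · exact hA x h
  · obtain ⟨y, hy, -⟩ := Relation.TransGen.head'_iff.1 hx
    exact h y hy

section Labelling

variable {V : Type*} {T : SimpleGraph V} {n : ℕ} {v u : Fin n → V}

theorem mem_faces_directedTreeComplex_iff [Finite V] {F : Finset (V × V)} :
    F ∈ (directedTreeComplex (doubleDirected T)).faces ↔
      F.Nonempty ∧ (∀ a b, (a, b) ∈ F → T.Adj a b) ∧ IsAcyclicEdgeSet (F : Set (V × V)) ∧
        ∀ a b c, (a, c) ∈ F → (b, c) ∈ F → a = b := by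
  constructor
  · rintro ⟨h1, h2, h3⟩
    exact ⟨h1, fun a b h => h2 _ h, h3.acyclic_and_unique⟩
  · rintro ⟨h1, h2, h3, h4⟩
    exact ⟨h1, fun e he => h2 _ _ he, isDirectedForest_of_acyclic h3 h4⟩

theorem not_mem_swap_of_mem_faces [Finite V] {F : Finset (V × V)}
    (hF : F ∈ (directedTreeComplex (doubleDirected T)).faces) {a b : V} (h : (a, b) ∈ F) :
    (b, a) ∉ F := fun h' =>
  (mem_faces_directedTreeComplex_iff.1 hF).2.2.1 a
    (.tail (.single (show (a, b) ∈ (F : Set (V × V)) from h)) h')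

theorem orientedEdges_subset_iff [DecidableEq V] {F : Finset (V × V)} :
    orientedEdges v u ⊆ F ↔ ∀ i, (v i, u i) ∈ F := by
  simp [orientedEdges, Finset.image_subset_iff]

namespace IsLabelling

section

variable (h : IsLabelling T v u)
include h

theorem v_injective : Function.Injective v := h.bijective.1.comp Sum.inl_injective

theorem u_injective : Function.Injective u := h.bijective.1.comp Sum.inr_injective

theorem v_ne_u (i j : Fin n) : v i ≠ u j := fun hij => by
  have := @h.bijective.1 (Sum.inl i) (Sum.inr j) hij
  simp at this

theorem exists_eq (x : V) : (∃ i, x = v i) ∨ ∃ i, x = u i := by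
  obtain ⟨i | i, rfl⟩ := h.bijective.2 x
  · exact Or.inl ⟨i, rfl⟩
  · exact Or.inr ⟨i, rfl⟩

theorem eq_of_adj_v {i : Fin n} {x : V} (hx : T.Adj (v i) x) : x = u i :=
  (h.leaf i).unique hx (h.adj i)

theorem exists_eq_of_adj {a b : V} (hab : T.Adj a b) :
    (∃ i, a = v i ∧ b = u i) ∨ (∃ i, a = u i ∧ b = v i) ∨ ∃ i j, i ≠ j ∧ a = u i ∧ b = u j := by
  rcases h.exists_eq a with ⟨i, rfl⟩ | ⟨i, rfl⟩
  · exact Or.inl ⟨i, rfl, h.eq_of_adj_v hab⟩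
  · rcases h.exists_eq b with ⟨j, rfl⟩ | ⟨j, rfl⟩
    · have := h.u_injective (h.eq_of_adj_v hab.symm)
      exact Or.inr (Or.inl ⟨i, rfl, by rw [this]⟩)
    · refine Or.inr (Or.inr ⟨i, j, ?_, rfl, rfl⟩)
      rintro rfl
      exact T.irrefl hab

/-- Otherwise `u i` and `v i` would form a whole connected component. -/
theorem exists_adj_u (hT : T.Connected) (hn : 2 ≤ n) (i : Fin n) :
    ∃ j, j ≠ i ∧ T.Adj (u j) (u i) := by
  by_contra! hno
  have key : ∀ x, T.Reachable (u i) x → x = u i ∨ x = v i := by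
    intro x hx
    rw [SimpleGraph.reachable_iff_reflTransGen] at hx
    induction hx with
    | refl => exact Or.inl rfl
    | tail _ hab ih =>
      rcases ih with rfl | rfl
      · rcases h.exists_eq_of_adj hab with ⟨k, h1, -⟩ | ⟨k, h1, h2⟩ | ⟨k, l, hkl, h1, h2⟩
        · exact absurd h1.symm (h.v_ne_u _ _)
        · rw [h2, h.u_injective h1]; exact Or.inr rfl
        · obtain rfl := h.u_injective h1
          rw [h2] at hab
          exact absurd hab.symm (hno l hkl.symm)
      · exact Or.inl (h.eq_of_adj_v hab)
  have : Nontrivial (Fin n) := Fin.nontrivial_iff_two_le.2 hn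
  obtain ⟨j, hj⟩ := exists_ne i
  rcases key (u j) (hT.preconnected _ _) with h1 | h1
  · exact hj (h.u_injective h1)
  · exact h.v_ne_u _ _ h1.symm

end

variable [Finite V] {F : Finset (V × V)}

/-- The only possible edge out of `v i` is `(v i, u i)`, absent whenever `(u i, v i)` is added, so
the new edges end in sinks. Only `u i` can point to `v i`, so in-degrees stay at most one. -/
theorem union_mem_faces [DecidableEq V] (h : IsLabelling T v u)
    (hF : F ∈ (directedTreeComplex (doubleDirected T)).faces) :
    F ∪ (Finset.univ.filter fun i => (v i, u i) ∉ F).image (fun i => (u i, v i)) ∈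
      (directedTreeComplex (doubleDirected T)).faces := by
  obtain ⟨h1, h2, h3, h4⟩ := mem_faces_directedTreeComplex_iff.1 hF
  have hnew : ∀ a b, (a, b) ∈ (Finset.univ.filter fun i => (v i, u i) ∉ F).image
      (fun i => (u i, v i)) ↔ ∃ i, (v i, u i) ∉ F ∧ u i = a ∧ v i = b := by
    intro a b
    simp
  refine mem_faces_directedTreeComplex_iff.2 ⟨h1.mono Finset.subset_union_left, ?_, ?_, ?_⟩
  · intro a b hab
    rcases Finset.mem_union.1 hab with hab | hab
    · exact h2 _ _ hab
    · obtain ⟨i, -, rfl, rfl⟩ := (hnew _ _).1 hab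
      exact (h.adj i).symm
  · rw [Finset.coe_union]
    refine h3.union_of_sinks fun a b c hab hbc => ?_
    obtain ⟨i, hi, rfl, rfl⟩ := (hnew _ _).1 hab
    rcases hbc with hbc | hbc
    · rw [h.eq_of_adj_v (h2 _ _ hbc)] at hbc
      exact hi hbc
    · obtain ⟨j, -, h5, -⟩ := (hnew _ _).1 hbc
      exact h.v_ne_u _ _ h5.symm
  · have hv : ∀ a i, (a, v i) ∈ F ∪ (Finset.univ.filter fun i => (v i, u i) ∉ F).image
        (fun i => (u i, v i)) → a = u i := by
      intro a i ha
      rcases Finset.mem_union.1 ha with ha | ha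
      · exact h.eq_of_adj_v (h2 _ _ ha).symm
      · obtain ⟨j, -, rfl, hj⟩ := (hnew _ _).1 ha
        rw [h.v_injective hj]
    have hu : ∀ a i, (a, u i) ∈ F ∪ (Finset.univ.filter fun i => (v i, u i) ∉ F).image
        (fun i => (u i, v i)) → (a, u i) ∈ F := by
      intro a i ha
      rcases Finset.mem_union.1 ha with ha | ha
      · exact ha
      · obtain ⟨j, -, -, hj⟩ := (hnew _ _).1 ha
        exact absurd hj (h.v_ne_u _ _)
    intro a b c hac hbc
    rcases h.exists_eq c with ⟨i, rfl⟩ | ⟨i, rfl⟩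
    · rw [hv _ _ hac, hv _ _ hbc]
    · exact h4 _ _ _ (hu _ _ hac) (hu _ _ hbc)

/-- The face complex of a labelled basic tree contains the boundary of a cross-polytope: from
every leaf edge at most one of the two orientations is chosen. -/
theorem mem_faces_of_sign (h : IsLabelling T v u) (p : Fin n → Prop) (hne : F.Nonempty)
    (hF : ∀ e ∈ F, (∃ i, e = (v i, u i) ∧ p i) ∨ ∃ i, e = (u i, v i) ∧ ¬ p i) :
    F ∈ (directedTreeComplex (doubleDirected T)).faces := by
  classical
  refine mem_faces_directedTreeComplex_iff.2 ⟨hne, ?_, ?_, ?_⟩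
  · intro a b hab
    rcases hF _ hab with ⟨i, hi, -⟩ | ⟨i, hi, -⟩
    · obtain ⟨rfl, rfl⟩ := Prod.mk.inj hi
      exact h.adj i
    · obtain ⟨rfl, rfl⟩ := Prod.mk.inj hi
      exact (h.adj i).symm
  -- Heights: leaves used as sources at `0`, the `u i` at `1`, the remaining leaves at `2`.
  · refine isAcyclicEdgeSet_of_lt
      (fun x => if ∃ i, x = u i then 1 else if ∃ i, x = v i ∧ p i then 0 else 2) ?_
    have hu : ∀ i, (if ∃ j, u i = u j then 1 else if ∃ j, u i = v j ∧ p j then 0 else 2) = 1 :=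
      fun i => if_pos ⟨i, rfl⟩
    have hv : ∀ i, (if ∃ j, v i = u j then 1 else if ∃ j, v i = v j ∧ p j then 0 else 2) =
        if p i then 0 else 2 := by
      intro i
      rw [if_neg (by rintro ⟨j, hj⟩; exact h.v_ne_u _ _ hj)]
      congr 1
      refine propext ⟨?_, fun hp => ⟨i, rfl, hp⟩⟩
      rintro ⟨j, hj, hp⟩
      rwa [h.v_injective hj]
    intro a b hab
    rcases hF _ hab with ⟨i, hi, hp⟩ | ⟨i, hi, hp⟩
    · obtain ⟨rfl, rfl⟩ := Prod.mk.inj hi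
      simp only [hu, hv, hp, if_true]
      exact one_pos
    · obtain ⟨rfl, rfl⟩ := Prod.mk.inj hi
      simp only [hu, hv, hp, if_false]
      exact Nat.one_lt_two
  · intro a b c hac hbc
    rcases hF _ hac with ⟨i, hi, hp⟩ | ⟨i, hi, hp⟩ <;>
    rcases hF _ hbc with ⟨j, hj, hp'⟩ | ⟨j, hj, hp'⟩ <;>
    obtain ⟨rfl, rfl⟩ := Prod.mk.inj hi <;> obtain ⟨rfl, hc⟩ := Prod.mk.inj hj
    · rw [h.u_injective hc]
    · exact absurd hc.symm (h.v_ne_u _ _)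
    · exact absurd hc (h.v_ne_u _ _)
    · rw [h.v_injective hc]

/-- Every `u j` already has its incoming edge from `v j`, which rules out further edges into it, and
`(u i, v i)` would close a 2-cycle. -/
theorem isFacet_orientedEdges [DecidableEq V] (h : IsLabelling T v u) (hn : n ≠ 0) :
    IsFacet (directedTreeComplex (doubleDirected T)) (orientedEdges v u) := by
  have : NeZero n := ⟨hn⟩
  refine ⟨h.mem_faces_of_sign (fun _ => True) ⟨_, Finset.mem_image_of_mem _ (Finset.mem_univ 0)⟩
    fun e he => ?_, ?_⟩
  · obtain ⟨i, -, rfl⟩ := Finset.mem_image.1 he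
    exact Or.inl ⟨i, rfl, trivial⟩
  · rintro F hF hsub ⟨a, b⟩ hab
    replace hsub := orientedEdges_subset_iff.1 hsub
    obtain ⟨-, h2, -, h4⟩ := mem_faces_directedTreeComplex_iff.1 hF
    rcases h.exists_eq_of_adj (h2 _ _ hab) with ⟨i, rfl, rfl⟩ | ⟨i, rfl, rfl⟩ | ⟨i, j, -, rfl, rfl⟩
    · exact Finset.mem_image_of_mem _ (Finset.mem_univ i)
    · exact absurd hab (not_mem_swap_of_mem_faces hF (hsub i))
    · exact absurd (h4 _ _ _ (hsub j) hab) (h.v_ne_u _ _)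

/-- A facet all of whose edges are incident to leaves is `orientedEdges v u`. -/
theorem eq_orientedEdges_of_isFacet [DecidableEq V] (h : IsLabelling T v u) (hT : T.Connected)
    (hn : 2 ≤ n) (hF : IsFacet (directedTreeComplex (doubleDirected T)) F)
    (hper : ∀ e ∈ F, (∃ i, e = (v i, u i)) ∨ ∃ i, e = (u i, v i)) :
    F = orientedEdges v u := by
  have hFf : F ∈ (directedTreeComplex (doubleDirected T)).faces := hF.prop
  by_cases hsub : ∀ i, (v i, u i) ∈ F
  · exact (Maximal.eq_of_le (P := fun G => G ∈ (directedTreeComplex (doubleDirected T)).faces)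
      (h.isFacet_orientedEdges (by omega)) hFf (orientedEdges_subset_iff.2 hsub)).symm
  exfalso
  push Not at hsub
  obtain ⟨i, hi⟩ := hsub
  -- If `(v i, u i)` is missing, nothing enters `u i`, so the edge from a neighbour `u j` can be
  -- added, against maximality.
  obtain ⟨j, hji, hadj⟩ := h.exists_adj_u hT hn i
  have hnot : (u j, u i) ∉ F := fun hmem => by
    rcases hper _ hmem with ⟨k, hk⟩ | ⟨k, hk⟩
    · exact h.v_ne_u _ _ (Prod.mk.inj hk).1.symm
    · exact h.v_ne_u _ _ (Prod.mk.inj hk).2.symm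
  have hin : ∀ a, (a, u i) ∉ F := fun a hmem => by
    rcases hper _ hmem with ⟨k, hk⟩ | ⟨k, hk⟩
    · obtain ⟨rfl, hik⟩ := Prod.mk.inj hk
      obtain rfl := h.u_injective hik
      exact hi hmem
    · exact h.v_ne_u _ _ (Prod.mk.inj hk).2.symm
  obtain ⟨h1, h2, h3, h4⟩ := mem_faces_directedTreeComplex_iff.1 hFf
  refine hnot (hF.2 (y := insert (u j, u i) F) ?_ (Finset.subset_insert _ _)
    (Finset.mem_insert_self _ _))
  refine mem_faces_directedTreeComplex_iff.2 ⟨Finset.insert_nonempty _ _, ?_, ?_, ?_⟩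
  · intro a b hab
    rcases Finset.mem_insert.1 hab with hab | hab
    · obtain ⟨rfl, rfl⟩ := Prod.mk.inj hab
      exact hadj
    · exact h2 _ _ hab
  -- Heights as before, with `u i` raised just above the other `u k` to accommodate the new edge.
  · let f : V → ℕ := fun x => if x = u i then 3 else if ∃ k, x = u k then 2 else
      if ∃ k, x = v k ∧ (v k, u k) ∈ F then 0 else 5
    have hfi : f (u i) = 3 := if_pos rfl
    have hfu : ∀ k, k ≠ i → f (u k) = 2 := fun k hk => by
      simp only [f]
      rw [if_neg fun hc => hk (h.u_injective hc), if_pos ⟨k, rfl⟩]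
    have hfu3 : ∀ k, f (u k) = 2 ∨ f (u k) = 3 := fun k => by
      by_cases hk : k = i
      · rw [hk]; exact Or.inr hfi
      · exact Or.inl (hfu k hk)
    have hfv : ∀ k, f (v k) = if (v k, u k) ∈ F then 0 else 5 := fun k => by
      simp only [f]
      rw [if_neg (h.v_ne_u _ _), if_neg (by rintro ⟨l, hl⟩; exact h.v_ne_u _ _ hl)]
      congr 1
      refine propext ⟨?_, fun hp => ⟨k, rfl, hp⟩⟩
      rintro ⟨l, hl, hp⟩
      rwa [h.v_injective hl]
    refine isAcyclicEdgeSet_of_lt f ?_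
    intro a b hab
    rcases Finset.mem_insert.1 (Finset.mem_coe.1 hab) with hab | hab
    · obtain ⟨rfl, rfl⟩ := Prod.mk.inj hab
      rw [hfi, hfu j hji]
      exact Nat.lt_succ_self 2
    · rcases hper _ hab with ⟨k, hk⟩ | ⟨k, hk⟩ <;> obtain ⟨rfl, rfl⟩ := Prod.mk.inj hk
      · rw [hfv, if_pos hab]
        rcases hfu3 k with hk | hk <;> omega
      · rw [hfv, if_neg (not_mem_swap_of_mem_faces hFf hab)]
        rcases hfu3 k with hk | hk <;> omega
  · intro a b c hac hbc
    rcases Finset.mem_insert.1 hac with hac | hac <;> rcases Finset.mem_insert.1 hbc with hbc | hbc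
    · rw [(Prod.mk.inj hac).1, (Prod.mk.inj hbc).1]
    · rw [(Prod.mk.inj hac).2] at hbc
      exact absurd hbc (hin _)
    · rw [(Prod.mk.inj hbc).2] at hac
      exact absurd hac (hin _)
    · exact h4 _ _ _ hac hbc

end IsLabelling

theorem IsBasicTree.ne_zero [Finite V] (hT : IsBasicTree T n) : n ≠ 0 := by
  rintro rfl
  have : Nonempty V := hT.1.connected.nonempty
  exact (Nat.card_pos (α := V)).ne' (by simpa using hT.2.1)

/-- Enumerate the non-leaves as `u` and attach to each its leaf. This is injective since a leaf has
one neighbour, and the count `2 * n` gives bijectivity. The two-vertex tree is treated by hand. -/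
theorem IsBasicTree.exists_isLabelling [Finite V] (hT : IsBasicTree T n) :
    ∃ v u : Fin n → V, IsLabelling T v u := by
  have := Fintype.ofFinite V
  classical
  obtain ⟨htree, hcard, h2 | ⟨hleaf, hnon, huniq⟩⟩ := hT
  · obtain rfl : n = 1 := by omega
    rw [Nat.card_eq_two_iff] at h2
    obtain ⟨x, y, hxy, hall⟩ := h2
    have hall' : ∀ z, z = x ∨ z = y := fun z => by
      have : z ∈ ({x, y} : Set V) := hall ▸ Set.mem_univ z
      simpa using this
    have : Nontrivial V := ⟨x, y, hxy⟩
    have hadj : T.Adj x y := by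
      obtain ⟨z, hz⟩ := htree.connected.preconnected.exists_adj_of_nontrivial x
      rcases hall' z with rfl | rfl
      · exact absurd hz T.irrefl
      · exact hz
    refine ⟨fun _ => x, fun _ => y, ⟨⟨?_, ?_⟩, fun _ => ⟨y, hadj, ?_⟩, fun _ => hadj⟩⟩
    · rintro (a | a) (b | b) hab
      · rw [Subsingleton.elim a b]
      · exact absurd hab hxy
      · exact absurd hab hxy.symm
      · rw [Subsingleton.elim a b]
    · intro z
      rcases hall' z with rfl | rfl
      · exact ⟨Sum.inl 0, rfl⟩
      · exact ⟨Sum.inr 0, rfl⟩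
    · intro z hz
      rcases hall' z with rfl | rfl
      · exact absurd hz T.irrefl
      · rfl
  · have hcardN : Nat.card {x | ¬ IsLeafOf T x} = n := by rw [Nat.card_coe_set_eq, hnon]
    let e : Fin n ≃ {x | ¬ IsLeafOf T x} := (Finite.equivFinOfCardEq hcardN).symm
    choose w hw _ using huniq
    let u : Fin n → V := fun i => e i
    let v : Fin n → V := fun i => w (e i) (e i).2
    have hv : ∀ i, IsLeafOf T (v i) ∧ T.Adj (u i) (v i) := fun i => hw (e i) (e i).2
    have hvinj : Function.Injective v := by
      intro i j hij
      have h1 := (hv i).2.symm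
      rw [hij] at h1
      exact e.injective (Subtype.ext ((hv j).1.unique h1 (hv j).2.symm))
    have huinj : Function.Injective u := Subtype.val_injective.comp e.injective
    refine ⟨v, u, ⟨?_, fun i => (hv i).1, fun i => (hv i).2.symm⟩⟩
    rw [Fintype.bijective_iff_injective_and_card]
    refine ⟨?_, by rw [← Nat.card_eq_fintype_card (α := V), hcard]; simp [two_mul]⟩
    rintro (a | a) (b | b) hab
    · exact congrArg Sum.inl (hvinj hab)
    · exact absurd (hv a).1 (by rw [show v a = u b from hab]; exact (e b).2)
    · exact absurd (hv b).1 (by rw [← show u a = v b from hab]; exact (e a).2)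
    · exact congrArg Sum.inr (huinj hab)

end Labelling

/-! ### Comparison with the cross-polytope -/

section CrossPolytope

variable {V : Type*} {n : ℕ}

/-- The map from the realization to the cross-polytope: the edge from `v i` to `u i` goes to the
basis vector `i`, and every edge that ends in `u i` or in `v i` otherwise to its negative. -/
def toCross (v u : Fin n → V) (x : V × V → ℝ) (i : Fin n) : ℝ :=
  x (v i, u i) - x (u i, v i) - ∑ j, x (u j, u i)

theorem continuous_toCross (v u : Fin n → V) : Continuous (toCross v u) := by
  unfold toCross
  fun_prop

/-- No cancellation: with `(v i, u i)` in a face, the reverse edge is excluded by acyclicity and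
every `(u j, u i)` by the in-degree bound. -/
theorem IsLabelling.toCross_pos [Fintype V] {T : SimpleGraph V} {v u : Fin n → V}
    (h : IsLabelling T v u) {F : Finset (V × V)} {x : V × V → ℝ}
    (hF : F ∈ (directedTreeComplex (doubleDirected T)).faces)
    (hx : x ∈ openSimplex F) {i : Fin n} (hi : (v i, u i) ∈ F) : 0 < toCross v u x i := by
  have h0 : ∀ e, e ∉ F → x e = 0 := fun e he => by
    by_contra hne
    exact he ((hx.2 e).1 hne)
  rw [toCross, h0 _ (not_mem_swap_of_mem_faces hF hi), Finset.sum_eq_zero, sub_zero, sub_zero]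
  · exact (hx.1.1 _).lt_of_ne' ((hx.2 _).2 hi)
  · intro j _
    exact h0 _ fun hj => h.v_ne_u _ _ ((mem_faces_directedTreeComplex_iff.1 hF).2.2.2 _ _ _ hi hj)

theorem toCross_eq_neg [Fintype V] {v u : Fin n → V} {F : Finset (V × V)} {x : V × V → ℝ}
    (hx : x ∈ openSimplex F) {i : Fin n} (hi : (v i, u i) ∉ F) :
    toCross v u x i = -(x (u i, v i) + ∑ j, x (u j, u i)) := by
  have : x (v i, u i) = 0 := by
    by_contra hne
    exact hi ((hx.2 _).1 hne)
  rw [toCross, this]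
  ring

theorem toCross_nonpos [Fintype V] {v u : Fin n → V} {F : Finset (V × V)} {x : V × V → ℝ}
    (hx : x ∈ openSimplex F) {i : Fin n} (hi : (v i, u i) ∉ F) :
    toCross v u x i ≤ 0 := by
  rw [toCross_eq_neg hx hi]
  exact neg_nonpos.2 (add_nonneg (hx.1.1 _) (Finset.sum_nonneg fun _ _ => hx.1.1 _))

theorem mem_of_toCross_pos [Fintype V] {v u : Fin n → V} {F : Finset (V × V)} {x : V × V → ℝ}
    (hx : x ∈ openSimplex F) {i : Fin n} (hi : 0 < toCross v u x i) :
    (v i, u i) ∈ F := by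
  by_contra hF
  exact (toCross_nonpos hx hF).not_gt hi

/-- Any edge of the face contributes to some coordinate, and all contributions to that coordinate
have the same sign. -/
theorem IsLabelling.toCross_ne_zero [Fintype V] {T : SimpleGraph V} {v u : Fin n → V}
    (h : IsLabelling T v u) {F : Finset (V × V)} {x : V × V → ℝ}
    (hF : F ∈ (directedTreeComplex (doubleDirected T)).faces)
    (hx : x ∈ openSimplex F) : toCross v u x ≠ 0 := by
  intro h0
  have h0' : ∀ i, toCross v u x i = 0 := fun i => congrFun h0 i
  have hnot : ∀ i, (v i, u i) ∉ F := fun i hi => (h.toCross_pos hF hx hi).ne' (h0' i)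
  obtain ⟨⟨⟨a, b⟩, hab⟩, h2, -, -⟩ := mem_faces_directedTreeComplex_iff.1 hF
  have hpos : 0 < x (a, b) := (hx.1.1 _).lt_of_ne' ((hx.2 _).2 hab)
  rcases h.exists_eq_of_adj (h2 _ _ hab) with ⟨i, rfl, rfl⟩ | ⟨i, rfl, rfl⟩ | ⟨i, j, -, rfl, rfl⟩
  · exact hnot i hab
  · have h3 := toCross_eq_neg hx (hnot i)
    have h4 : 0 ≤ ∑ j, x (u j, u i) := Finset.sum_nonneg fun _ _ => hx.1.1 _
    rw [h0'] at h3
    linarith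
  · have h3 := toCross_eq_neg hx (hnot j)
    have h4 : x (u i, u j) ≤ ∑ k, x (u k, u j) :=
      Finset.single_le_sum (f := fun k => x (u k, u j)) (fun _ _ => hx.1.1 _) (Finset.mem_univ i)
    have h5 := hx.1.1 (u j, v j)
    rw [h0'] at h3
    linarith

/-- The point of the cross-polytope with edges `(v i, u i)` and `(u i, v i)` on the ray of `y`. -/
noncomputable def ofCross [DecidableEq V] (v u : Fin n → V) (y : Fin n → ℝ) (e : V × V) : ℝ :=
  (∑ i, ((if e = (v i, u i) then max (y i) 0 else 0) +
    if e = (u i, v i) then max (-y i) 0 else 0)) / ∑ i, |y i|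

theorem sum_abs_pos {y : Fin n → ℝ} (hy : y ≠ 0) : 0 < ∑ i, |y i| := by
  obtain ⟨i, hi⟩ := Function.ne_iff.1 hy
  exact Finset.sum_pos' (fun _ _ => abs_nonneg _) ⟨i, Finset.mem_univ i, abs_pos.2 hi⟩

variable [DecidableEq V]

theorem continuousOn_ofCross (v u : Fin n → V) : ContinuousOn (ofCross v u) {0}ᶜ := by
  refine continuousOn_pi.2 fun e => ?_
  unfold ofCross
  refine ContinuousOn.div (Continuous.continuousOn ?_) (Continuous.continuousOn (by fun_prop))
    fun y hy => (sum_abs_pos hy).ne'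
  refine continuous_finsetSum _ fun i _ => ?_
  split_ifs <;> fun_prop

variable {v u : Fin n → V}

theorem ofCross_ne_zero {y : Fin n → ℝ} {e : V × V} (he : ofCross v u y e ≠ 0) :
    (∃ i, e = (v i, u i) ∧ 0 < y i) ∨ ∃ i, e = (u i, v i) ∧ y i < 0 := by
  contrapose! he
  obtain ⟨h1, h2⟩ := he
  rw [ofCross, Finset.sum_eq_zero, zero_div]
  intro i _
  have h3 : (if e = (v i, u i) then max (y i) 0 else 0) = 0 := by
    split_ifs with h
    · exact max_eq_right (h1 i h)
    · rfl
  have h4 : (if e = (u i, v i) then max (-y i) 0 else 0) = 0 := by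
    split_ifs with h
    · exact max_eq_right (neg_nonpos.2 (h2 i h))
    · rfl
  rw [h3, h4, add_zero]

theorem ofCross_mem_stdSimplex [Fintype V] {y : Fin n → ℝ} (hy : y ≠ 0) :
    ofCross v u y ∈ stdSimplex ℝ (V × V) := by
  refine ⟨fun e => div_nonneg (Finset.sum_nonneg fun i _ => add_nonneg ?_ ?_)
    (sum_abs_pos hy).le, ?_⟩
  · split_ifs
    exacts [le_max_right _ _, le_rfl]
  · split_ifs
    exacts [le_max_right _ _, le_rfl]
  · simp only [ofCross]
    rw [← Finset.sum_div, Finset.sum_comm, div_eq_one_iff_eq (sum_abs_pos hy).ne']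
    refine Finset.sum_congr rfl fun i _ => ?_
    rw [Finset.sum_add_distrib, Finset.sum_ite_eq', Finset.sum_ite_eq',
      if_pos (Finset.mem_univ _), if_pos (Finset.mem_univ _)]
    rcases le_total 0 (y i) with h | h
    · rw [max_eq_left h, max_eq_right (by linarith), abs_of_nonneg h, add_zero]
    · rw [max_eq_right h, max_eq_left (by linarith), abs_of_nonpos h, zero_add]

namespace IsLabelling

variable {T : SimpleGraph V} (h : IsLabelling T v u)
include h

theorem ofCross_v_u (y : Fin n → ℝ) (i : Fin n) :
    ofCross v u y (v i, u i) = max (y i) 0 / ∑ i, |y i| := by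
  rw [ofCross, Finset.sum_eq_single i]
  · rw [if_pos rfl, if_neg fun hi => h.v_ne_u _ _ (Prod.mk.inj hi).1, add_zero]
  · intro j _ hj
    rw [if_neg fun hi => hj (h.v_injective (Prod.mk.inj hi).1).symm,
      if_neg fun hi => h.v_ne_u _ _ (Prod.mk.inj hi).1, add_zero]
  · exact fun hi => absurd (Finset.mem_univ i) hi

theorem ofCross_u_v (y : Fin n → ℝ) (i : Fin n) :
    ofCross v u y (u i, v i) = max (-y i) 0 / ∑ i, |y i| := by
  rw [ofCross, Finset.sum_eq_single i]
  · rw [if_pos rfl, if_neg fun hi => h.v_ne_u _ _ (Prod.mk.inj hi).2, zero_add]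
  · intro j _ hj
    rw [if_neg fun hi => h.v_ne_u _ _ (Prod.mk.inj hi).2,
      if_neg fun hi => hj (h.u_injective (Prod.mk.inj hi).1).symm, add_zero]
  · exact fun hi => absurd (Finset.mem_univ i) hi

theorem ofCross_u_u (y : Fin n → ℝ) (i j : Fin n) : ofCross v u y (u i, u j) = 0 := by
  by_contra hne
  rcases ofCross_ne_zero hne with ⟨k, hk, -⟩ | ⟨k, hk, -⟩
  · exact h.v_ne_u _ _ (Prod.mk.inj hk).1.symm
  · exact h.v_ne_u _ _ (Prod.mk.inj hk).2.symm

theorem toCross_ofCross (y : Fin n → ℝ) :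
    toCross v u (ofCross v u y) = (∑ i, |y i|)⁻¹ • y := by
  ext i
  simp only [toCross, h.ofCross_v_u, h.ofCross_u_v, h.ofCross_u_u, Finset.sum_const_zero, sub_zero,
    Pi.smul_apply, smul_eq_mul]
  rw [← sub_div, inv_mul_eq_div]
  congr 1
  rcases le_total 0 (y i) with hi | hi
  · rw [max_eq_left hi, max_eq_right (by linarith), sub_zero]
  · rw [max_eq_right hi, max_eq_left (by linarith), zero_sub, neg_neg]

variable [Fintype V]

theorem ofCross_mem {y : Fin n → ℝ} (hy : y ≠ 0) :
    ofCross v u y ∈ geomRealization (directedTreeComplex (doubleDirected T)) := by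
  have hstd := ofCross_mem_stdSimplex (v := v) (u := u) hy
  refine mem_geomRealization_of_support_subset (F := Finset.univ.filter fun e => ofCross v u y e ≠ 0)
    hstd (h.mem_faces_of_sign (fun i => 0 < y i) ?_ ?_) (by simp)
  · by_contra hne
    rw [Finset.not_nonempty_iff_eq_empty, Finset.filter_eq_empty_iff] at hne
    have h1 : ∑ e, ofCross v u y e = 0 := Finset.sum_eq_zero fun e he => by simpa using hne he
    rw [hstd.2] at h1
    exact one_ne_zero h1
  · intro e he
    rcases ofCross_ne_zero (Finset.mem_filter.1 he).2 with ⟨i, hi, hp⟩ | ⟨i, hi, hp⟩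
    · exact Or.inl ⟨i, hi, hp⟩
    · exact Or.inr ⟨i, hi, hp.le.not_gt⟩

variable {F : Finset (V × V)} {x : V × V → ℝ}

/-- Both endpoints are supported in the enlarged face of `union_mem_faces`: a positive coordinate
needs `(v i, u i)` in `F`, a negative one needs it absent. -/
theorem segment_subset (hx : x ∈ geomRealization (directedTreeComplex (doubleDirected T))) :
    segment ℝ (ofCross v u (toCross v u x)) x ⊆
      geomRealization (directedTreeComplex (doubleDirected T)) := by
  obtain ⟨F, hF, hxF⟩ := mem_geomRealization_iff.1 hx
  intro z hz
  refine mem_geomRealization_of_support_subset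
    ((convex_stdSimplex ℝ _).segment_subset (ofCross_mem_stdSimplex (h.toCross_ne_zero hF hxF))
      hxF.1 hz) (h.union_mem_faces hF) fun e he => ?_
  obtain ⟨a, b, -, -, -, rfl⟩ := hz
  rw [Finset.mem_union]
  by_cases hxe : x e = 0
  · have hne : ofCross v u (toCross v u x) e ≠ 0 := by
      intro h0
      exact he (by simp [h0, hxe])
    rcases ofCross_ne_zero hne with ⟨i, rfl, hi⟩ | ⟨i, rfl, hi⟩
    · exact Or.inl (mem_of_toCross_pos hxF hi)
    · refine Or.inr (Finset.mem_image_of_mem _ (Finset.mem_filter.2 ⟨Finset.mem_univ _, ?_⟩))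
      exact fun hmem => (h.toCross_pos hF hxF hmem).not_gt hi
  · exact Or.inl ((hxF.2 e).1 hxe)

/-- The realization is homotopy equivalent to a punctured Euclidean space. -/
theorem nonempty_homotopyEquiv_compl_zero :
    Nonempty (ContinuousMap.HomotopyEquiv
      ↥(geomRealization (directedTreeComplex (doubleDirected T))) ↥({0}ᶜ : Set (Fin n → ℝ))) := by
  refine nonempty_homotopyEquiv_of_segment_subset (continuous_toCross v u).continuousOn
    (continuousOn_ofCross v u) ?_ (fun y hy => h.ofCross_mem hy) (fun x hx => h.segment_subset hx) ?_
  · intro x hx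
    obtain ⟨F, hF, hxF⟩ := mem_geomRealization_iff.1 hx
    exact h.toCross_ne_zero hF hxF
  · rintro y hy _ ⟨a, b, ha, hb, hab, rfl⟩
    rw [h.toCross_ofCross, smul_smul, ← add_smul]
    refine smul_ne_zero (ne_of_gt ?_) hy
    have := inv_pos.2 (sum_abs_pos hy)
    rcases ha.eq_or_lt with rfl | ha
    · rw [zero_add] at hab
      simp [hab]
    · positivity

theorem isGeneratingSet_orientedEdges (hn : n ≠ 0) :
    IsGeneratingSet (directedTreeComplex (doubleDirected T)) {orientedEdges v u} := by
  have : NeZero n := ⟨hn⟩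
  refine ⟨fun F hF => hF ▸ h.isFacet_orientedEdges hn, ?_⟩
  rw [Set.biUnion_singleton]
  -- The nonzero vectors outside the open positive orthant; `toCross` is in that orthant exactly on
  -- the interior of `G`.
  let Q : Set (Fin n → ℝ) := {y | y ≠ 0 ∧ ∃ i, y i ≤ 0}
  have hstar : StarConvex ℝ (fun _ => -1 : Fin n → ℝ) Q := by
    rintro y ⟨hy, i, hi⟩ a b ha hb hab
    refine ⟨fun h0 => ?_, i, ?_⟩
    · have h1 : ∀ j, b * y j = a := fun j => by
        have := congrFun h0 j
        simp only [Pi.add_apply, Pi.smul_apply, smul_eq_mul, Pi.zero_apply] at this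
        linarith
      have h2 : a = 0 := le_antisymm
        (by rw [← h1 i]; exact mul_nonpos_of_nonneg_of_nonpos hb hi) ha
      refine hy (funext fun j => ?_)
      have := h1 j
      rw [h2, zero_add] at hab
      rwa [hab, one_mul, h2] at this
    · simp only [Pi.add_apply, Pi.smul_apply, smul_eq_mul]
      nlinarith [mul_nonneg hb (neg_nonneg.2 hi)]
  have hQne : Q.Nonempty := ⟨fun _ => -1, fun h0 => by simpa using congrFun h0 0, 0, by simp⟩
  have : ContractibleSpace Q := hstar.contractibleSpace hQne
  obtain ⟨e⟩ : Nonempty (ContinuousMap.HomotopyEquiv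
      ↥(geomRealization (directedTreeComplex (doubleDirected T)) \ openSimplex (orientedEdges v u))
      Q) := by
    have hG : ∀ x ∈ openSimplex (orientedEdges v u), ∀ i, x (v i, u i) ≠ 0 := fun x hx i =>
      (hx.2 _).2 (Finset.mem_image_of_mem _ (Finset.mem_univ i))
    refine nonempty_homotopyEquiv_of_segment_subset (continuous_toCross v u).continuousOn
      ((continuousOn_ofCross v u).mono fun y hy => hy.1) ?_ ?_ ?_ ?_
    · rintro x ⟨hx, hxG⟩
      obtain ⟨F, hF, hxF⟩ := mem_geomRealization_iff.1 hx
      refine ⟨h.toCross_ne_zero hF hxF, ?_⟩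
      by_contra! hall
      refine hxG (openSimplex_eq_of_subset_support hx (h.isFacet_orientedEdges hn) fun e he => ?_)
      obtain ⟨i, -, rfl⟩ := Finset.mem_image.1 he
      exact (hxF.2 _).2 (mem_of_toCross_pos hxF (hall i))
    · rintro y ⟨hy, i, hi⟩
      refine ⟨h.ofCross_mem hy, fun hmem => hG _ hmem i ?_⟩
      rw [h.ofCross_v_u, max_eq_right hi, zero_div]
    · rintro x ⟨hx, hxG⟩ z hz
      refine ⟨h.segment_subset hx hz, fun hzG => ?_⟩
      obtain ⟨F, hF, hxF⟩ := mem_geomRealization_iff.1 hx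
      -- An edge of `G` missing at `x` has coordinate zero along the whole segment, which therefore
      -- avoids the interior of `G`.
      obtain ⟨i, hi⟩ : ∃ i, (v i, u i) ∉ F := by
        by_contra! hall
        refine hxG (openSimplex_eq_of_subset_support hx (h.isFacet_orientedEdges hn) fun e he => ?_)
        obtain ⟨i, -, rfl⟩ := Finset.mem_image.1 he
        exact (hxF.2 _).2 (hall i)
      refine hG _ hzG i ?_
      obtain ⟨a, b, -, -, -, rfl⟩ := hz
      have h1 : x (v i, u i) = 0 := by
        by_contra hne
        exact hi ((hxF.2 _).1 hne)
      simp [h.ofCross_v_u, h1, max_eq_right (toCross_nonpos hxF hi)]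
    · rintro y ⟨hy, i, hi⟩ _ ⟨a, b, ha, hb, hab, rfl⟩
      rw [h.toCross_ofCross, smul_smul, ← add_smul]
      have hc : 0 < a * (∑ i, |y i|)⁻¹ + b := by
        have := inv_pos.2 (sum_abs_pos hy)
        rcases ha.eq_or_lt with rfl | ha
        · rw [zero_add] at hab
          simp [hab]
        · positivity
      exact ⟨smul_ne_zero hc.ne' hy, i, mul_nonpos_of_nonneg_of_nonpos hc.le hi⟩
  exact e.contractibleSpace

/-- The complex stays non-contractible when facets outside the cross-polytope are removed. -/
theorem exists_mem_of_isGeneratingSet {S : Set (Finset (V × V))}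
    (hS : IsGeneratingSet (directedTreeComplex (doubleDirected T)) S) :
    ∃ F ∈ S, ∀ e ∈ F, (∃ i, e = (v i, u i)) ∨ ∃ i, e = (u i, v i) := by
  by_contra! hno
  let X := ↥(geomRealization (directedTreeComplex (doubleDirected T)) \ ⋃ F ∈ S, openSimplex F)
  have : ContractibleSpace X := hS.2
  have hz0 : ∀ z : Metric.sphere (0 : Fin n → ℝ) 1, (z : Fin n → ℝ) ≠ 0 := fun z h0 => by
    have hz : ‖(z : Fin n → ℝ)‖ = 1 := by simp
    rw [h0, norm_zero] at hz
    exact zero_ne_one hz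
  -- The sphere of the cross-polytope avoids the removed interiors, since each removed facet has an
  -- edge not incident to a leaf.
  let g : Metric.sphere (0 : Fin n → ℝ) 1 → X := fun z =>
    ⟨ofCross v u z, h.ofCross_mem (hz0 z), fun hmem => by
      simp only [Set.mem_iUnion] at hmem
      obtain ⟨F, hF, hmem⟩ := hmem
      obtain ⟨e, he, h1, h2⟩ := hno F hF
      rcases ofCross_ne_zero ((hmem.2 e).2 he) with ⟨i, hi, -⟩ | ⟨i, hi, -⟩
      · exact h1 i hi
      · exact h2 i hi⟩
  have hg : Continuous g :=
    ((continuousOn_ofCross v u).comp_continuous continuous_subtype_val hz0).subtype_mk _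
  rcases exists_eq_zero_or_eq_neg_smul hg (Θ := fun x => toCross v u x.1)
    ((continuous_toCross v u).comp continuous_subtype_val) with ⟨⟨x, hx, _⟩, h0⟩ | ⟨z, c, hc, hz⟩
  · obtain ⟨F, hF, hxF⟩ := mem_geomRealization_iff.1 hx
    exact h.toCross_ne_zero hF hxF h0
  -- `toCross` returns a positive multiple of `z`, so it is never opposite to `z`.
  · change toCross v u (ofCross v u z) = _ at hz
    rw [h.toCross_ofCross, eq_neg_iff_add_eq_zero, ← add_smul] at hz
    have := inv_pos.2 (sum_abs_pos (hz0 z))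
    exact smul_ne_zero (by positivity) (hz0 z) hz

end IsLabelling

end CrossPolytope

/-! ### The round sphere and the conclusion -/

/-- The unit sphere is homotopy equivalent to the punctured space. -/
theorem nonempty_homotopyEquiv_sphere (n : ℕ) :
    Nonempty (ContinuousMap.HomotopyEquiv ↥({0}ᶜ : Set (Fin n → ℝ))
      ↥(Metric.sphere (0 : EuclideanSpace ℝ (Fin n)) 1)) := by
  have hne : ∀ y : Fin n → ℝ, y ≠ 0 → WithLp.toLp 2 y ≠ 0 := fun y hy h0 =>
    hy (congrArg WithLp.ofLp h0)
  refine nonempty_homotopyEquiv_of_segment_subset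
    (φ := fun y => ‖WithLp.toLp 2 y‖⁻¹ • WithLp.toLp 2 y) (ψ := WithLp.ofLp)
    ?_ (by fun_prop) ?_ ?_ ?_ ?_
  · have hc : Continuous fun y : Fin n → ℝ => (WithLp.toLp 2 y : EuclideanSpace ℝ (Fin n)) := by
      fun_prop
    exact (hc.norm.continuousOn.inv₀ fun y hy => norm_ne_zero_iff.2 (hne y hy)).smul hc.continuousOn
  · intro y hy
    rw [mem_sphere_zero_iff_norm, norm_smul, norm_inv, norm_norm,
      inv_mul_cancel₀ (norm_ne_zero_iff.2 (hne y hy))]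
  · intro z hz h0
    have hz0 : z = 0 := by
      rw [Set.mem_singleton_iff] at h0
      exact congrArg (WithLp.toLp 2) h0
    rw [hz0] at hz
    simp at hz
  · rintro y hy _ ⟨a, b, ha, hb, hab, rfl⟩
    have := inv_pos.2 (norm_pos_iff.2 (hne y hy))
    change a • (‖WithLp.toLp 2 y‖⁻¹ • y) + b • y ≠ 0
    rw [smul_smul, ← add_smul]
    refine smul_ne_zero (ne_of_gt ?_) hy
    rcases ha.eq_or_lt with rfl | ha
    · rw [zero_add] at hab
      simp [hab]
    · positivity
  · intro z hz
    have h1 : ‖z‖ = 1 := by simpa using hz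
    have h2 : ‖WithLp.toLp 2 z.ofLp‖⁻¹ • WithLp.toLp 2 z.ofLp = z := by
      rw [WithLp.toLp_ofLp, h1, inv_one, one_smul]
    simp only [h2, segment_same]
    exact Set.singleton_subset_iff.2 hz

theorem IsLabelling.symm_of_eq_one {V : Type*} {T : SimpleGraph V} {v u : Fin 1 → V}
    (h : IsLabelling T v u) : IsLabelling T u v := by
  refine ⟨?_, fun i => ⟨v i, (h.adj i).symm, fun y hy => ?_⟩, fun i => (h.adj i).symm⟩
  · have : Sum.elim u v = Sum.elim v u ∘ Sum.swap := by
      ext (a | a) <;> rfl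
    rw [this]
    exact h.bijective.comp (Equiv.sumComm _ _).bijective
  · rcases h.exists_eq_of_adj hy with ⟨j, hj, -⟩ | ⟨j, -, rfl⟩ | ⟨j, k, hjk, -⟩
    · exact absurd hj.symm (h.v_ne_u _ _)
    · rw [Subsingleton.elim j i]
    · exact absurd (Subsingleton.elim j k) hjk

theorem mainTheorem11 {V : Type*} [Fintype V] [DecidableEq V] (n : ℕ) (T : SimpleGraph V)
    (hT : IsBasicTree T n) :
    Nonempty (ContinuousMap.HomotopyEquiv
      ↥(geomRealization (directedTreeComplex (doubleDirected T)))
      ↥(Metric.sphere (0 : EuclideanSpace ℝ (Fin n)) 1)) ∧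
    (∃ v u : Fin n → V, IsLabelling T v u) ∧
    ∀ v u : Fin n → V, IsLabelling T v u →
      IsGeneratingSet (directedTreeComplex (doubleDirected T)) {orientedEdges v u} ∧
      (2 ≤ n → ∀ S : Set (Finset (V × V)),
        IsGeneratingSet (directedTreeComplex (doubleDirected T)) S → S = {orientedEdges v u}) ∧
      (n = 1 → ∀ S : Set (Finset (V × V)),
        IsGeneratingSet (directedTreeComplex (doubleDirected T)) S →
          S = {orientedEdges v u} ∨ S = {orientedEdges u v}) := by
  have hn := hT.ne_zero
  refine ⟨?_, hT.exists_isLabelling, fun v u h => ⟨h.isGeneratingSet_orientedEdges hn, ?_, ?_⟩⟩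
  · obtain ⟨v, u, h⟩ := hT.exists_isLabelling
    obtain ⟨e⟩ := h.nonempty_homotopyEquiv_compl_zero
    obtain ⟨e'⟩ := nonempty_homotopyEquiv_sphere n
    exact ⟨e.trans e'⟩
  · intro hn2 S hS
    obtain ⟨F, hFS, hF⟩ := h.exists_mem_of_isGeneratingSet hS
    rw [h.eq_orientedEdges_of_isFacet hT.1.connected hn2 (hS.1 F hFS) hF] at hFS
    exact ((h.isGeneratingSet_orientedEdges hn).eq_of_subset hS
      (Set.singleton_subset_iff.2 hFS)).symm
  · rintro rfl S hS
    obtain ⟨F, hFS, hF⟩ := h.exists_mem_of_isGeneratingSet hS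
    obtain ⟨e, he⟩ := ((mem_faces_directedTreeComplex_iff).1 (hS.1 F hFS).prop).1
    -- Stated for an arbitrary labelling, since for `n = 1` swapping `v` and `u` gives another one
    -- and `F` may be either orientation.
    have key : ∀ {v u : Fin 1 → V}, IsLabelling T v u → ∀ i, (v i, u i) ∈ F →
        S = {orientedEdges v u} := by
      intro v u h i hi
      have hFe : orientedEdges v u = F :=
        Maximal.eq_of_le (P := fun G => G ∈ (directedTreeComplex (doubleDirected T)).faces)
          (h.isFacet_orientedEdges hn) (hS.1 F hFS).prop
          (orientedEdges_subset_iff.2 fun j => Subsingleton.elim i j ▸ hi)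
      exact ((h.isGeneratingSet_orientedEdges hn).eq_of_subset hS
        (Set.singleton_subset_iff.2 (hFe ▸ hFS))).symm
    rcases hF e he with ⟨i, rfl⟩ | ⟨i, rfl⟩
    · exact Or.inl (key h i he)
    · exact Or.inr (key h.symm_of_eq_one i he)
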